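/- **Setting.** An uplink cell-free network has $M\ge 1$ access points (APs) with $N$ antennas each, $K$ single-antenna users (UEs), coherence blocks of $\tau_c$ channel uses, and $\tau_p\le\tau_c$ mutually orthogonal pilots $\boldsymbol\phi_1,\dots,\boldsymbol\phi_{\tau_p}\in\mathbb C^{\tau_p}$ with $\|\boldsymbol\phi_t\|^2=\tau_p$. UE $k$ has transmit power $p_k\ge 0$ and uses pilot $\boldsymbol\phi_{t_k}$; $\mathcal P_k=\{l: t_l=t_k\}$ is the set of UEs with the same pilot as UE $k$; the noise power is $\sigma^2>0$. The channel between AP $m$ and UE $k$ is $\mathbf g_{mk}=\bar{\mathbf g}_{mk}e^{j\theta_{mk}}+\check{\mathbf g}_{mk}\in\mathbb C^N$, with deterministic $\bar{\mathbf g}_{mk}$, $\theta_{mk}\sim\mathcal U[-\pi,\pi]$ and $\check{\mathbf g}_{mk}\sim\mathcal N_{\mathbb C}(\mathbf 0,\check{\mathbf R}_{mk})$, where $\check{\mathbf R}_{mk}$ is positive semidefinite. AP $m$ receives the pilot signal $\mathbf Y_m^p=\sum_{k=1}^K\sqrt{p_k}\,\mathbf g_{mk}\boldsymbol\phi_{t_k}^T+\mathbf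 N_m^p$, where $\mathbf N^p_m$ has independent $\mathcal N_{\mathbb C}(0,\sigma^2)$ entries; all $\theta_{mk}$, $\check{\mathbf g}_{mk}$ and all noise entries are mutually independent. With $\mathbf y_{mk}^p=\mathbf Y_m^p\boldsymbol\phi_{t_k}^*$, $\bar{\mathbf y}_{mk}^p=\sum_{l\in\mathcal P_k}\sqrt{p_l}\tau_p\bar{\mathbf g}_{ml}e^{j\theta_{ml}}$ and $\mathbf\Psi_{mk}=\sum_{l\in\mathcal P_k}p_l\tau_p\check{\mathbf R}_{ml}+\sigma^2\mathbf I_N$, the phase-aware MMSE channel estimate is $$\hat{\mathbf g}_{mk}=\bar{\mathbf g}_{mk}e^{j\theta_{mk}}+\sqrt{p_k}\,\check{\mathbf R}_{mk}\mathbf\Psi_{mk}^{-1}(\mathbf y_{mk}^p-\bar{\mathbf y}_{mk}^p).$$ AP $m$ uses the bilinear-equalizer combining vector $\mathbf v_{mk}=\mathbf W_{mk}\hat{\mathbf g}_{mk}$ with an arbitrary deterministic $\mathbf W_{mk}\in\mathbb C^{N\times N}$. The CPU applies large-scale fading decoding (LSFD) with weights $\mathbf a_k\in\mathbb C^M$,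 and the use-and-then-forget (UatF) spectral efficiency of UE $k$ is $\mathrm{SE}_k=\frac{\tau_c-\tau_p}{\tau_c}\log_2(1+\mathrm{SINR}_k)$ with $$\mathrm{SINR}_k(\mathbf a_k)=\frac{p_k|\mathbf a_k^H\mathbb E\{\mathbf b_{kk}\}|^2}{\mathbf a_k^H\big(\sum_{l=1}^Kp_l\mathbf\Xi_{kl}-p_k\mathbb E\{\mathbf b_{kk}\}\mathbb E\{\mathbf b_{kk}^H\}+\sigma^2\mathbf D_k\big)\mathbf a_k},$$ where $\mathbf b_{kk}=[\mathbf v_{1k}^H\mathbf g_{1k},\dots,\mathbf v_{Mk}^H\mathbf g_{Mk}]^T$, $\mathbf D_k=\mathrm{diag}[\mathbb E\|\mathbf v_{1k}\|^2,\dots,\mathbb E\|\mathbf v_{Mk}\|^2]$ and $[\mathbf\Xi_{kl}]_{nm}=\mathbb E\{(\mathbf v_{mk}^H\mathbf g_{ml})^H(\mathbf v_{nk}^H\mathbf g_{nl})\}$. **Notation.** $\bar{\mathbf G}_{mll}=\bar{\mathbf g}_{ml}\bar{\mathbf g}_{ml}^H$, $\hat{\mathbf R}_{mk}=p_k\tau_p\check{\mathbf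 R}_{mk}\mathbf\Psi_{mk}^{-1}\check{\mathbf R}_{mk}$, $\bar{\mathbf R}_{mk}=\bar{\mathbf G}_{mkk}+\hat{\mathbf R}_{mk}$; for $l\in\mathcal P_k\setminus\{k\}$, $\mathbf B_{mlk}=\sqrt{p_kp_l}\,\tau_p\check{\mathbf R}_{ml}\mathbf\Psi_{mk}^{-1}\check{\mathbf R}_{mk}$, and $\mathbf B_{mkk}=\bar{\mathbf G}_{mkk}+p_k\tau_p\check{\mathbf R}_{mk}\mathbf\Psi_{mk}^{-1}\check{\mathbf R}_{mk}$; $$\varphi_{mkl}=\mathrm{tr}(\mathbf W_{mk}^H\bar{\mathbf G}_{mll}\mathbf W_{mk}\bar{\mathbf G}_{mkk})+\mathrm{tr}(\mathbf W_{mk}^H\check{\mathbf R}_{ml}\mathbf W_{mk}\bar{\mathbf G}_{mkk})+\mathrm{tr}(\mathbf W_{mk}^H\bar{\mathbf G}_{mll}\mathbf W_{mk}\hat{\mathbf R}_{mk})+\mathrm{tr}(\mathbf W_{mk}^H\check{\mathbf R}_{ml}\mathbf W_{mk}\hat{\mathbf R}_{mk});$$ $\upsilon_{mkl}=p_kp_l\tau_p^2|\mathrm{tr}(\mathbf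 W_{mk}^H\check{\mathbf R}_{ml}\mathbf\Psi_{mk}^{-1}\check{\mathbf R}_{mk})|^2$ for $l\in\mathcal P_k\setminus\{k\}$, and for $l=k$ the same expression plus $$p_k\tau_p\mathrm{tr}(\mathbf W_{mk}^H\bar{\mathbf G}_{mkk})\mathrm{tr}(\mathbf W_{mk}\check{\mathbf R}_{mk}\mathbf\Psi_{mk}^{-1}\check{\mathbf R}_{mk})+p_k\tau_p\mathrm{tr}(\mathbf W_{mk}^H\check{\mathbf R}_{mk}\mathbf\Psi_{mk}^{-1}\check{\mathbf R}_{mk})\mathrm{tr}(\mathbf W_{mk}\bar{\mathbf G}_{mkk}).$$ **Theorem.** All the expectations above exist, and for every UE $k$: 1. $\mathbb E\{\mathbf b_{kk}\}=\bar{\mathbf b}_{kk}:=[\mathrm{tr}(\mathbf W_{1k}^H\bar{\mathbf R}_{1k}),\dots,\mathrm{tr}(\mathbf W_{Mk}^H\bar{\mathbf R}_{Mk})]^T$, $\mathbf D_k=\bar{\mathbf D}_k:=\mathrm{diag}[\mathrm{tr}(\mathbf W_{1k}\bar{\mathbf R}_{1k}\mathbf W_{1k}^H),\dots,\mathrm{tr}(\mathbf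 W_{Mk}\bar{\mathbf R}_{Mk}\mathbf W_{Mk}^H)]$, and $\mathbf\Xi_{kl}=\bar{\mathbf\Xi}_{kl}$ for every $l$, where for $l\notin\mathcal P_k$: $[\bar{\mathbf\Xi}_{kl}]_{mm}=\varphi_{mkl}$ and $[\bar{\mathbf\Xi}_{kl}]_{nm}=0$ for $m\ne n$; and for $l\in\mathcal P_k$: $[\bar{\mathbf\Xi}_{kl}]_{mm}=\varphi_{mkl}+\upsilon_{mkl}$ and $[\bar{\mathbf\Xi}_{kl}]_{nm}=\mathrm{tr}(\mathbf W_{mk}\mathbf B_{mkl})\,\mathrm{tr}(\mathbf W_{nk}^H\mathbf B_{nlk})$ for $m\ne n$. 2. The matrix $\mathbf A_k:=\sum_{l=1}^Kp_l\bar{\mathbf\Xi}_{kl}-p_k\bar{\mathbf b}_{kk}\bar{\mathbf b}_{kk}^H+\sigma^2\bar{\mathbf D}_k$ is positive semidefinite, and for every $\mathbf a_k\in\mathbb C^M$, $$\mathrm{SE}_k=\frac{\tau_c-\tau_p}{\tau_c}\log_2\Big(1+\frac{p_k|\mathbf a_k^H\bar{\mathbf b}_{kk}|^2}{\mathbf a_k^H\mathbf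 A_k\mathbf a_k}\Big).$$ 3. $\mathbf A_k$ is invertible if and only if $\mathrm{tr}(\mathbf W_{mk}\bar{\mathbf R}_{mk}\mathbf W_{mk}^H)\neq 0$ for all $m$ (no combining vector $\mathbf v_{mk}$ vanishes almost surely). In that case $\mathbf A_k$ is positive definite, the vector $\big(\sum_lp_l\mathbf\Xi_{kl}-p_k\mathbb E\{\mathbf b_{kk}\}\mathbb E\{\mathbf b_{kk}^H\}+\sigma^2\mathbf D_k\big)^{-1}\mathbb E\{\mathbf b_{kk}\}$ equals $\bar{\mathbf a}_k^*=\mathbf A_k^{-1}\bar{\mathbf b}_{kk}$, the maximum of $\mathrm{SINR}_k(\mathbf a_k)$ over all $\mathbf a_k\ne\mathbf 0$ is $p_k\bar{\mathbf b}_{kk}^H\bar{\mathbf a}_k^*$, and, if $\bar{\mathbf b}_{kk}\ne\mathbf 0$, then $\bar{\mathbf a}_k^*\neq\mathbf 0$ and it attains this maximum. -/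

import Mathlib

open MeasureTheory ProbabilityTheory Matrix
open scoped Matrix NNReal ComplexOrder

namespace CellFree

noncomputable section

/-- The law `𝒩_ℂ(0, v)` on `ℂ`: independent real and imaginary parts, each `𝒩(0, v / 2)`. -/
def complexNormal (v : ℝ≥0) : Measure ℂ :=
  ((gaussianReal 0 (v / 2)).prod (gaussianReal 0 (v / 2))).map
    (fun z : ℝ × ℝ => (z.1 : ℂ) + (z.2 : ℂ) * Complex.I)

/-- `X ∼ 𝒩_ℂ(0, R)`: the random vector `X` is distributed as `L w`, where `w` has independent
`𝒩_ℂ(0, 1)` entries and `L Lᴴ = R` (the law of `L w` is the same for all such `L`). -/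
def IsComplexNormal {N : ℕ} {Ω : Type*} [MeasurableSpace Ω] (X : Ω → (Fin N → ℂ))
    (R : Matrix (Fin N) (Fin N) ℂ) (μ : Measure Ω) : Prop :=
  ∃ L : Matrix (Fin N) (Fin N) ℂ, L * Lᴴ = R ∧
    HasLaw X ((Measure.pi fun _ : Fin N => complexNormal 1).map fun w => L *ᵥ w) μ

/-- The deterministic parameters of an uplink cell-free network with `M` access points (APs) of
`N` antennas each, `K` single-antenna users (UEs) and `τp` orthogonal pilots. -/
structure Network (M N K τp : ℕ) where
  /-- line-of-sight component `ḡ_{mk}` -/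
  los : Fin M → Fin K → (Fin N → ℂ)
  /-- spatial correlation matrix `Ř_{mk}` of the non-line-of-sight component -/
  corr : Fin M → Fin K → Matrix (Fin N) (Fin N) ℂ
  corr_posSemidef : ∀ m k, (corr m k).PosSemidef
  /-- transmit power `p_k` -/
  power : Fin K → ℝ
  power_nonneg : ∀ k, 0 ≤ power k
  /-- noise power `σ²` -/
  noisePower : ℝ
  noisePower_pos : 0 < noisePower
  /-- pilot sequences `φ_1, …, φ_{τp}`, mutually orthogonal with `‖φ_t‖² = τp` -/
  pilot : Fin τp → (Fin τp → ℂ)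
  pilot_orthogonal : ∀ s t, pilot s ⬝ᵥ star (pilot t) = if s = t then (τp : ℂ) else 0
  /-- index `t_k` of the pilot sent by UE `k` -/
  pilotIndex : Fin K → Fin τp
  /-- length of a coherence block -/
  τc : ℕ
  τp_le_τc : τp ≤ τc

/-- The sources of randomness in the channel and in the pilot transmission phase. -/
structure Channel {M N K τp : ℕ} (S : Network M N K τp) {Ω : Type*} [MeasurableSpace Ω]
    (μ : Measure Ω) where
  /-- phase-shift `θ_{mk}` -/
  phase : Fin M → Fin K → Ω → ℝ
  /-- non-line-of-sight component `ǧ_{mk}` -/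
  nlos : Fin M → Fin K → Ω → (Fin N → ℂ)
  /-- `(n, s)` entry of the noise `N_m^p` during pilot transmission -/
  noise : Fin M → Fin N → Fin τp → Ω → ℂ
  phase_law : ∀ m k, pdf.IsUniform (phase m k) (Set.Icc (-Real.pi) Real.pi) μ
  nlos_law : ∀ m k, IsComplexNormal (nlos m k) (S.corr m k) μ
  noise_law : ∀ m n s, HasLaw (noise m n s) (complexNormal S.noisePower.toNNReal) μ
  phase_indep : iIndepFun (fun i : Fin M × Fin K => phase i.1 i.2) μ
  nlos_indep : iIndepFun (fun i : Fin M × Fin K => nlos i.1 i.2) μ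
  noise_indep : iIndepFun (fun i : Fin M × Fin N × Fin τp => noise i.1 i.2.1 i.2.2) μ
  /- the three families are mutually independent -/
  nlos_noise_indep :
    IndepFun (fun ω (m : Fin M) (k : Fin K) => nlos m k ω)
      (fun ω (m : Fin M) (n : Fin N) (s : Fin τp) => noise m n s ω) μ
  phase_nlos_noise_indep :
    IndepFun (fun ω (m : Fin M) (k : Fin K) => phase m k ω)
      (fun ω => ((fun (m : Fin M) (k : Fin K) => nlos m k ω),
        (fun (m : Fin M) (n : Fin N) (s : Fin τp) => noise m n s ω))) μ

section Model

variable {M N K τp : ℕ} (S : Network M N K τp)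

/-- The set `𝒫_k` of the UEs that use the same pilot as UE `k` (including `k`). -/
def Network.sharing (k : Fin K) : Finset (Fin K) :=
  Finset.univ.filter fun l => S.pilotIndex l = S.pilotIndex k

/-- `Ψ_{mk} = ∑_{l ∈ 𝒫_k} p_l τ_p Ř_{ml} + σ² I`. -/
def Network.Psi (m : Fin M) (k : Fin K) : Matrix (Fin N) (Fin N) ℂ :=
  (∑ l ∈ S.sharing k, ((S.power l : ℂ) * (τp : ℂ)) • S.corr m l) + (S.noisePower : ℂ) • 1

/-- `Ḡ_{mll} = ḡ_{ml} ḡ_{ml}ᴴ`. -/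
def Network.G (m : Fin M) (l : Fin K) : Matrix (Fin N) (Fin N) ℂ :=
  vecMulVec (S.los m l) (star (S.los m l))

/-- `R̂_{mk} = p_k τ_p Ř_{mk} Ψ_{mk}⁻¹ Ř_{mk}`. -/
def Network.Rhat (m : Fin M) (k : Fin K) : Matrix (Fin N) (Fin N) ℂ :=
  ((S.power k : ℂ) * (τp : ℂ)) • (S.corr m k * (S.Psi m k)⁻¹ * S.corr m k)

/-- `R̄_{mk} = Ḡ_{mkk} + p_k τ_p Ř_{mk} Ψ_{mk}⁻¹ Ř_{mk}`. -/
def Network.Rbar (m : Fin M) (k : Fin K) : Matrix (Fin N) (Fin N) ℂ :=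
  S.G m k + ((S.power k : ℂ) * (τp : ℂ)) • (S.corr m k * (S.Psi m k)⁻¹ * S.corr m k)

/-- `(τ_c - τ_p) / τ_c · log₂ (1 + x)`. -/
def Network.spectralEfficiency (x : ℝ) : ℝ :=
  ((S.τc : ℝ) - (τp : ℝ)) / (S.τc : ℝ) * Real.logb 2 (1 + x)

end Model

section Random

variable {M N K τp : ℕ} {S : Network M N K τp} {Ω : Type*} [MeasurableSpace Ω] {μ : Measure Ω}
  (C : Channel S μ)

/-- Line-of-sight part with its phase-shift, `ḡ_{mk} e^{j θ_{mk}}`. -/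
def Channel.losPart (m : Fin M) (k : Fin K) (ω : Ω) : Fin N → ℂ :=
  Complex.exp ((C.phase m k ω : ℂ) * Complex.I) • S.los m k

/-- The channel `g_{mk} = ḡ_{mk} e^{j θ_{mk}} + ǧ_{mk}`. -/
def Channel.g (m : Fin M) (k : Fin K) (ω : Ω) : Fin N → ℂ :=
  C.losPart m k ω + C.nlos m k ω

/-- The received pilot signal `Y_m^p = ∑_k √p_k g_{mk} φ_{t_k}ᵀ + N_m^p`. -/
def Channel.receivedPilot (m : Fin M) (ω : Ω) : Matrix (Fin N) (Fin τp) ℂ :=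
  (∑ k : Fin K, (Real.sqrt (S.power k) : ℂ) • vecMulVec (C.g m k ω) (S.pilot (S.pilotIndex k)))
    + Matrix.of fun n s => C.noise m n s ω

/-- The despread pilot signal `y_{mk}^p = Y_m^p φ_{t_k}^*`. -/
def Channel.y (m : Fin M) (k : Fin K) (ω : Ω) : Fin N → ℂ :=
  C.receivedPilot m ω *ᵥ star (S.pilot (S.pilotIndex k))

/-- `ȳ_{mk}^p = ∑_{l ∈ 𝒫_k} √p_l τ_p ḡ_{ml} e^{j θ_{ml}}`. -/
def Channel.ybar (m : Fin M) (k : Fin K) (ω : Ω) : Fin N → ℂ :=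
  ∑ l ∈ S.sharing k, ((Real.sqrt (S.power l) : ℂ) * (τp : ℂ)) • C.losPart m l ω

/-- The phase-aware MMSE estimate
`ĝ_{mk} = ḡ_{mk} e^{j θ_{mk}} + √p_k Ř_{mk} Ψ_{mk}⁻¹ (y_{mk}^p - ȳ_{mk}^p)`. -/
def Channel.ghat (m : Fin M) (k : Fin K) (ω : Ω) : Fin N → ℂ :=
  C.losPart m k ω + (Real.sqrt (S.power k) : ℂ) •
    ((S.corr m k * (S.Psi m k)⁻¹) *ᵥ (C.y m k ω - C.ybar m k ω))

variable (W : Fin M → Fin K → Matrix (Fin N) (Fin N) ℂ)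

/-- The local bilinear-equalizer combining vector `v_{mk} = W_{mk} ĝ_{mk}`. -/
def Channel.v (m : Fin M) (k : Fin K) (ω : Ω) : Fin N → ℂ :=
  W m k *ᵥ C.ghat m k ω

/-- The effective scalar channel `v_{mk}ᴴ g_{ml}`. -/
def Channel.eff (m : Fin M) (k l : Fin K) (ω : Ω) : ℂ :=
  star (C.v W m k ω) ⬝ᵥ C.g m l ω

/-- `E{b_{kk}}`, with `b_{kk} = [v_{1k}ᴴ g_{1k}, …, v_{Mk}ᴴ g_{Mk}]ᵀ`. -/
def Channel.meanB (k : Fin K) : Fin M → ℂ :=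
  fun m => ∫ ω, C.eff W m k k ω ∂μ

/-- `Ξ_{kl}`, with `(n, m)` entry `E{(v_{mk}ᴴ g_{ml})ᴴ (v_{nk}ᴴ g_{nl})}`. -/
def Channel.Xi (k l : Fin K) : Matrix (Fin M) (Fin M) ℂ :=
  Matrix.of fun n m => ∫ ω, star (C.eff W m k l ω) * C.eff W n k l ω ∂μ

/-- The squared Euclidean norm `‖v_{mk}‖²`. -/
def Channel.vNormSq (m : Fin M) (k : Fin K) (ω : Ω) : ℝ :=
  ∑ n : Fin N, ‖C.v W m k ω n‖ ^ 2

/-- `D_k = diag[E{‖v_{1k}‖²}, …, E{‖v_{Mk}‖²}]`. -/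
def Channel.D (k : Fin K) : Matrix (Fin M) (Fin M) ℂ :=
  Matrix.diagonal fun m => ((∫ ω, C.vNormSq W m k ω ∂μ : ℝ) : ℂ)

end Random

section LSFD

variable {M N K τp : ℕ} (S : Network M N K τp)

/-- `∑_l p_l Ξ_l - p_k b bᴴ + σ² D`. -/
def Network.lsfdMatrix (k : Fin K) (b : Fin M → ℂ) (X : Fin K → Matrix (Fin M) (Fin M) ℂ)
    (D : Matrix (Fin M) (Fin M) ℂ) : Matrix (Fin M) (Fin M) ℂ :=
  (∑ l : Fin K, (S.power l : ℂ) • X l) - (S.power k : ℂ) • vecMulVec b (star b)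
    + (S.noisePower : ℂ) • D

/-- `p_k |aᴴ b|² / (aᴴ (∑_l p_l Ξ_l - p_k b bᴴ + σ² D) a)`. -/
def Network.lsfdSINR (k : Fin K) (b : Fin M → ℂ) (X : Fin K → Matrix (Fin M) (Fin M) ℂ)
    (D : Matrix (Fin M) (Fin M) ℂ) (a : Fin M → ℂ) : ℝ :=
  S.power k * ‖star a ⬝ᵥ b‖ ^ 2 / (star a ⬝ᵥ (S.lsfdMatrix k b X D *ᵥ a)).re

/-- `(∑_l p_l Ξ_l - p_k b bᴴ + σ² D)⁻¹ b`. -/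
def Network.lsfdWeights (k : Fin K) (b : Fin M → ℂ) (X : Fin K → Matrix (Fin M) (Fin M) ℂ)
    (D : Matrix (Fin M) (Fin M) ℂ) : Fin M → ℂ :=
  (S.lsfdMatrix k b X D)⁻¹ *ᵥ b

/-- `SINR_k^LSFD` for the weights `a`, in terms of expectations. -/
def Channel.SINR {S : Network M N K τp} {Ω : Type*} [MeasurableSpace Ω] {μ : Measure Ω}
    (C : Channel S μ) (W : Fin M → Fin K → Matrix (Fin N) (Fin N) ℂ) (k : Fin K)
    (a : Fin M → ℂ) : ℝ :=
  S.lsfdSINR k (C.meanB W k) (C.Xi W k) (C.D W k) a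

/-- `SE_k^LSFD`, the use-and-then-forget spectral efficiency for the weights `a`. -/
def Channel.SE {S : Network M N K τp} {Ω : Type*} [MeasurableSpace Ω] {μ : Measure Ω}
    (C : Channel S μ) (W : Fin M → Fin K → Matrix (Fin N) (Fin N) ℂ) (k : Fin K)
    (a : Fin M → ℂ) : ℝ :=
  S.spectralEfficiency (C.SINR W k a)

end LSFD

section ClosedForm

variable {M N K τp : ℕ} (S : Network M N K τp)
  (W : Fin M → Fin K → Matrix (Fin N) (Fin N) ℂ)

/-- `b̄_{kk} = [tr(W_{1k}ᴴ R̄_{1k}), …, tr(W_{Mk}ᴴ R̄_{Mk})]ᵀ`. -/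
def Network.bBar (k : Fin K) : Fin M → ℂ :=
  fun m => ((W m k)ᴴ * S.Rbar m k).trace

/-- `D̄_k = diag[tr(W_{1k} R̄_{1k} W_{1k}ᴴ), …, tr(W_{Mk} R̄_{Mk} W_{Mk}ᴴ)]`. -/
def Network.DBar (k : Fin K) : Matrix (Fin M) (Fin M) ℂ :=
  Matrix.diagonal fun m => (W m k * S.Rbar m k * (W m k)ᴴ).trace

/-- `φ_{mkl}`. -/
def Network.phi (m : Fin M) (k l : Fin K) : ℂ :=
  ((W m k)ᴴ * S.G m l * W m k * S.G m k).trace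
    + ((W m k)ᴴ * S.corr m l * W m k * S.G m k).trace
    + ((W m k)ᴴ * S.G m l * W m k * S.Rhat m k).trace
    + ((W m k)ᴴ * S.corr m l * W m k * S.Rhat m k).trace

/-- `υ_{mkl}` (used for `l ∈ 𝒫_k` only). -/
def Network.upsilon (m : Fin M) (k l : Fin K) : ℂ :=
  (S.power k : ℂ) * (S.power l : ℂ) * (τp : ℂ) ^ 2 *
      ((‖((W m k)ᴴ * S.corr m l * (S.Psi m k)⁻¹ * S.corr m k).trace‖ ^ 2 : ℝ) : ℂ)
    + if l = k then
        (S.power k : ℂ) * (τp : ℂ) * ((W m k)ᴴ * S.G m k).trace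
            * (W m k * S.corr m k * (S.Psi m k)⁻¹ * S.corr m k).trace
          + (S.power k : ℂ) * (τp : ℂ)
            * ((W m k)ᴴ * S.corr m k * (S.Psi m k)⁻¹ * S.corr m k).trace
            * (W m k * S.G m k).trace
      else 0

/-- `B_{mlk}` (used for UEs `l`, `k` that share a pilot only; then `Ψ_{ml} = Ψ_{mk}`). -/
def Network.B (m : Fin M) (l k : Fin K) : Matrix (Fin N) (Fin N) ℂ :=
  (if l = k then S.G m k else 0)
    + ((Real.sqrt (S.power k * S.power l) : ℂ) * (τp : ℂ)) •
      (S.corr m l * (S.Psi m k)⁻¹ * S.corr m k)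

/-- `Ξ̄_{kl}`, by its `(n, m)` entry. -/
def Network.XiBar (k l : Fin K) : Matrix (Fin M) (Fin M) ℂ :=
  Matrix.of fun n m =>
    if l ∈ S.sharing k then
      if m = n then S.phi W m k l + S.upsilon W m k l
      else (W m k * S.B m k l).trace * ((W n k)ᴴ * S.B n l k).trace
    else
      if m = n then S.phi W m k l else 0

/-- The closed-form SINR for the weights `a`. -/
def Network.SINRBar (k : Fin K) (a : Fin M → ℂ) : ℝ :=
  S.lsfdSINR k (S.bBar W k) (S.XiBar W k) (S.DBar W k) a

/-- The closed-form spectral efficiency for the weights `a`. -/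
def Network.SEBar (k : Fin K) (a : Fin M → ℂ) : ℝ :=
  S.spectralEfficiency (S.SINRBar W k a)

/-- `∑_l p_l Ξ̄_{kl} - p_k b̄_{kk} b̄_{kk}ᴴ + σ² D̄_k`. -/
def Network.lsfdMatrixBar (k : Fin K) : Matrix (Fin M) (Fin M) ℂ :=
  S.lsfdMatrix k (S.bBar W k) (S.XiBar W k) (S.DBar W k)

/-- `ā_k^* = (∑_l p_l Ξ̄_{kl} - p_k b̄_{kk} b̄_{kk}ᴴ + σ² D̄_k)⁻¹ b̄_{kk}`. -/
def Network.aBar (k : Fin K) : Fin M → ℂ :=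
  S.lsfdWeights k (S.bBar W k) (S.XiBar W k) (S.DBar W k)

end ClosedForm

end

end CellFree

/-!
All random quantities are linear in one vector `ρ` of scalar sources: the unit-modulus variables
`e^{jθ}`, the entries of the non-line-of-sight components and the entries of the pilot noise. In
particular `g_{ml} = Γ ρ` and, since the pilots are orthogonal, `ĝ_{mk} = V ρ`, so that
`v_{mk}ᴴ g_{ml} = ρᴴ A ρ` with `A = (W V)ᴴ Γ`, and only second and fourth moments of `ρ` are needed.

In law, `ρ = Λ ξ` with `Λ Λᴴ = Σ` the covariance matrix of `ρ` and `ξ` a vector of independent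
circular variables of unit variance (`Channel.exists_circular_representation`). By independence a
moment `E[ξ_i^* ξ_j ξ_k^* ξ_l]` vanishes unless the conjugated indices match the unconjugated ones,
which gives (`IsCircularFamily.integral_star_form_mul_form`)

`E[(ξᴴ P ξ)^* (ξᴴ Q ξ)] = (tr P)^* tr Q + tr (Pᴴ Q) - ∑ κ_i P_{ii}^* Q_{ii}`, `κ_i = 2 - E|ξ_i|⁴`.

For Gaussian entries `κ_i = 0`; for phases `κ_i = 1`. The first term depends on
`E[g_{ml} ĝ_{mk}ᴴ]`, which is `B_{mlk}` if the two UEs share a pilot and `0` otherwise. The second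
one is a trace of `E[ĝ_{mk} ĝ_{mk}ᴴ] = R̄_{mk}` against `E[g_{ml} g_{ml}ᴴ] = Ḡ_{mll} + Ř_{ml}`, that
is, `φ_{mkl}`; it is present for a single AP only. The third one removes `|tr (Wᴴ Ḡ_{mkk})|²` when
`l = k`, which turns the first one into `υ_{mkl}` (`Network.upsilon_eq`). These covariances are block
matrix computations.

The denominator is a nonnegative combination of second-moment matrices, of the covariance matrix
`Ξ_{kk} - E{b_{kk}} E{b_{kk}}ᴴ` and of `σ² D_k`; hence it is positive semidefinite, and positive
definite as soon as all diagonal entries of `D_k` are positive. If one of them is zero, the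
corresponding combining vector vanishes almost surely and a column of the denominator is zero. The
optimality of the weights is the Cauchy–Schwarz inequality for the inner product given by the
denominator (`isGreatest_rayleigh`).
-/

namespace CellFree

/-! ### Mixed moments of the scalar laws -/

/-- The mixed moment `E[z̄ᵃ zᵇ]`, `a, b ≤ 2`, of a circular variable with `E|z|² = 1` and
`E|z|⁴ = 2 - κ`. -/
noncomputable def circularMoment (κ : ℂ) (a b : ℕ) : ℂ :=
  if a = b then (if a = 2 then 2 - κ else 1) else 0

/-- A law on `ℂ` whose mixed moments up to degree `(2, 2)` are those of a unit-variance circular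
variable; `κ` measures how far `E|z|⁴` stays below the Gaussian value `2`. -/
def IsCircularLaw (ν : Measure ℂ) (κ : ℂ) : Prop :=
  ∀ a b : ℕ, a ≤ 2 → b ≤ 2 →
    Integrable (fun z : ℂ => star z ^ a * z ^ b) ν ∧
      ∫ z, star z ^ a * z ^ b ∂ν = circularMoment κ a b

lemma integral_sq_gaussianReal (s : ℝ≥0) : ∫ x, x ^ 2 ∂gaussianReal 0 s = s := by
  have h := variance_fun_id_gaussianReal (μ := 0) (v := s)
  rw [variance_of_integral_eq_zero aemeasurable_id' integral_id_gaussianReal] at h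
  exact h

lemma integrable_pow_gaussianReal (s : ℝ≥0) (n : ℕ) :
    Integrable (fun x : ℝ => x ^ n) (gaussianReal 0 s) := by
  have h := (memLp_id_gaussianReal (μ := 0) (v := s) (n : ℝ≥0)).integrable_norm_pow'
  refine h.mono' (by fun_prop) (ae_of_all _ fun x => ?_)
  simp

lemma integral_cube_gaussianReal (s : ℝ≥0) : ∫ x, x ^ 3 ∂gaussianReal 0 s = 0 := by
  have h : ∫ x, x ^ 3 ∂((gaussianReal 0 s).map (fun x => -x)) = ∫ x, (-x) ^ 3 ∂gaussianReal 0 s :=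
    integral_map (by fun_prop) (by fun_prop)
  rw [gaussianReal_map_neg, neg_zero] at h
  have h2 : ∫ x, (-x) ^ 3 ∂gaussianReal 0 s = -∫ x, x ^ 3 ∂gaussianReal 0 s := by
    rw [← integral_neg]; congr 1; ext x; ring
  linarith

/-- `x + y` and `√2 x` have the same law for independent `x, y ∼ 𝒩(0, s)`; comparing their fourth
moments determines `E x⁴`. -/
lemma integral_pow_four_gaussianReal (s : ℝ≥0) :
    ∫ x, x ^ 4 ∂gaussianReal 0 s = 3 * (s : ℝ) ^ 2 := by
  have hconv := gaussianReal_conv_gaussianReal (m₁ := 0) (m₂ := 0) (v₁ := s) (v₂ := s)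
  have hscale := gaussianReal_map_const_mul (μ := 0) (v := s) (Real.sqrt 2)
  have hv : NNReal.mk (Real.sqrt 2 ^ 2) (sq_nonneg _) * s = s + s := by
    ext; push_cast; rw [Real.sq_sqrt (by norm_num)]; ring
  rw [mul_zero, hv] at hscale
  rw [add_zero] at hconv
  have h1 : ∫ x, x ^ 4 ∂gaussianReal 0 (s + s) = 4 * ∫ x, x ^ 4 ∂gaussianReal 0 s := by
    rw [← hscale, integral_map (by fun_prop) (by fun_prop), ← integral_const_mul]
    congr 1; ext x
    rw [mul_pow, show Real.sqrt 2 ^ 4 = (Real.sqrt 2 ^ 2) ^ 2 by ring,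
      Real.sq_sqrt (by norm_num)]
    norm_num
  have I := integrable_pow_gaussianReal s
  have I' : ∀ a b : ℕ, Integrable (fun z : ℝ × ℝ => z.1 ^ a * z.2 ^ b) ((gaussianReal 0 s).prod (gaussianReal 0 s)) :=
    fun a b => (I a).mul_prod (I b)
  have E' : ∀ a b : ℕ, ∫ z : ℝ × ℝ, z.1 ^ a * z.2 ^ b ∂((gaussianReal 0 s).prod (gaussianReal 0 s))
      = (∫ x, x ^ a ∂gaussianReal 0 s) * ∫ x, x ^ b ∂gaussianReal 0 s :=
    fun a b => integral_prod_mul (fun x : ℝ => x ^ a) (fun x : ℝ => x ^ b)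
  have h2 : ∫ x, x ^ 4 ∂gaussianReal 0 (s + s)
      = 2 * (∫ x, x ^ 4 ∂gaussianReal 0 s) + 6 * (s : ℝ) ^ 2 := by
    rw [← hconv, Measure.conv, integral_map (by fun_prop) (by fun_prop)]
    have : (fun z : ℝ × ℝ => (z.1 + z.2) ^ 4) = fun z => z.1 ^ 4 * z.2 ^ 0
        + 4 * (z.1 ^ 3 * z.2 ^ 1) + 6 * (z.1 ^ 2 * z.2 ^ 2) + 4 * (z.1 ^ 1 * z.2 ^ 3)
        + z.1 ^ 0 * z.2 ^ 4 := by
      ext z; ring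
    rw [this, integral_add, integral_add, integral_add, integral_add]
    · simp only [integral_const_mul, E']
      simp only [integral_sq_gaussianReal, integral_cube_gaussianReal]
      simp
      ring
    · exact I' 4 0
    · exact (I' 3 1).const_mul 4
    · exact (I' 4 0).add ((I' 3 1).const_mul 4)
    · exact (I' 2 2).const_mul 6
    · exact ((I' 4 0).add ((I' 3 1).const_mul 4)).add ((I' 2 2).const_mul 6)
    · exact (I' 1 3).const_mul 4
    · exact (((I' 4 0).add ((I' 3 1).const_mul 4)).add ((I' 2 2).const_mul 6)).add
        ((I' 1 3).const_mul 4)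
    · exact I' 0 4
  linarith

instance (v : ℝ≥0) : IsProbabilityMeasure (complexNormal v) :=
  Measure.isProbabilityMeasure_map (by fun_prop)

lemma integrable_mixed_complexNormal (v : ℝ≥0) (a b : ℕ) :
    Integrable (fun z : ℂ => star z ^ a * z ^ b) (complexNormal v) := by
  have hLp : MemLp (fun z : ℝ × ℝ => (z.1 : ℂ) + (z.2 : ℂ) * Complex.I) ((a + b : ℕ) : ℝ≥0)
      ((gaussianReal 0 (v / 2)).prod (gaussianReal 0 (v / 2))) := by
    have h := memLp_id_gaussianReal (μ := 0) (v := v / 2) ((a + b : ℕ) : ℝ≥0)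
    have h1 := (h.comp_fst (gaussianReal 0 (v / 2))).ofReal (K := ℂ)
    have h2 := ((h.comp_snd (gaussianReal 0 (v / 2))).ofReal (K := ℂ)).mul_const Complex.I
    exact h1.add h2
  rw [complexNormal, integrable_map_measure (by fun_prop) (by fun_prop)]
  refine hLp.integrable_norm_pow'.mono' (by fun_prop) (ae_of_all _ fun z => ?_)
  rw [Function.comp_apply, norm_mul, norm_pow, norm_pow, norm_star, ← pow_add]

/-- Multiplication by `i` preserves `𝒩_ℂ(0, v)`. -/
lemma complexNormal_map_I_mul (v : ℝ≥0) :
    (complexNormal v).map (fun z => Complex.I * z) = complexNormal v := by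
  set g := gaussianReal 0 (v / 2) with hg
  have hneg : MeasurePreserving (fun x : ℝ => -x) g g :=
    ⟨by fun_prop, by rw [hg, gaussianReal_map_neg, neg_zero]⟩
  have hrot : MeasurePreserving (fun z : ℝ × ℝ => (-z.2, z.1)) (g.prod g) (g.prod g) :=
    (hneg.prod (MeasurePreserving.id g)).comp Measure.measurePreserving_swap
  rw [complexNormal, Measure.map_map (by fun_prop) (by fun_prop)]
  conv_rhs => rw [← hg, ← hrot.map_eq, Measure.map_map (by fun_prop) (by fun_prop)]
  congr 1
  ext z
  simp only [Function.comp]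
  push_cast
  linear_combination (z.2 : ℂ) * Complex.I_mul_I

lemma integral_mixed_complexNormal_of_ne (v : ℝ≥0) {a b : ℕ} (ha : a ≤ 2) (hb : b ≤ 2)
    (hab : a ≠ b) : ∫ z, star z ^ a * z ^ b ∂complexNormal v = 0 := by
  have h : ∫ z, star z ^ a * z ^ b ∂complexNormal v
      = (star Complex.I ^ a * Complex.I ^ b) * ∫ z, star z ^ a * z ^ b ∂complexNormal v := by
    conv_lhs => rw [← complexNormal_map_I_mul, integral_map (by fun_prop) (by fun_prop)]
    rw [← integral_const_mul]
    congr 1; ext z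
    simp only [star_mul', mul_pow]; ring
  -- `star I ^ a * I ^ b = I ^ (b - a)` with `0 < |b - a| ≤ 2`
  have hne : star Complex.I ^ a * Complex.I ^ b ≠ 1 := by
    interval_cases a <;> interval_cases b <;> simp [Complex.ext_iff, pow_succ] at hab ⊢ <;> norm_num
  have : (star Complex.I ^ a * Complex.I ^ b - 1) *
      ∫ z, star z ^ a * z ^ b ∂complexNormal v = 0 := by
    linear_combination -h
  exact (mul_eq_zero.mp this).resolve_left (sub_ne_zero.mpr hne)

lemma integral_normSq_complexNormal (v : ℝ≥0) :
    ∫ z, star z ^ 1 * z ^ 1 ∂complexNormal v = v := by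
  have I := integrable_pow_gaussianReal (v / 2)
  have I' := fun a b : ℕ => (I a).mul_prod (I b)
  rw [complexNormal, integral_map (by fun_prop) (by fun_prop)]
  have : (fun z : ℝ × ℝ => star ((z.1 : ℂ) + (z.2 : ℂ) * Complex.I) ^ 1
      * ((z.1 : ℂ) + (z.2 : ℂ) * Complex.I) ^ 1)
      = fun z => ((z.1 ^ 2 * z.2 ^ 0 + z.1 ^ 0 * z.2 ^ 2 : ℝ) : ℂ) := by
    ext z
    simp only [star_add, star_mul', Complex.star_def, Complex.conj_ofReal, Complex.conj_I]
    push_cast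
    linear_combination (-(z.2 : ℂ) ^ 2) * Complex.I_sq
  rw [this, integral_complex_ofReal, integral_add (I' 2 0) (I' 0 2)]
  rw [integral_prod_mul (fun x : ℝ => x ^ 2) (fun x : ℝ => x ^ 0),
    integral_prod_mul (fun x : ℝ => x ^ 0) (fun x : ℝ => x ^ 2), integral_sq_gaussianReal]
  simp

lemma integral_normSq_sq_complexNormal (v : ℝ≥0) :
    ∫ z, star z ^ 2 * z ^ 2 ∂complexNormal v = 2 * (v : ℂ) ^ 2 := by
  have I := integrable_pow_gaussianReal (v / 2)
  have I' := fun a b : ℕ => (I a).mul_prod (I b)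
  rw [complexNormal, integral_map (by fun_prop) (by fun_prop)]
  have : (fun z : ℝ × ℝ => star ((z.1 : ℂ) + (z.2 : ℂ) * Complex.I) ^ 2
      * ((z.1 : ℂ) + (z.2 : ℂ) * Complex.I) ^ 2)
      = fun z => ((z.1 ^ 4 * z.2 ^ 0 + 2 * (z.1 ^ 2 * z.2 ^ 2) + z.1 ^ 0 * z.2 ^ 4 : ℝ) : ℂ) := by
    ext z
    have h : star ((z.1 : ℂ) + (z.2 : ℂ) * Complex.I) * ((z.1 : ℂ) + (z.2 : ℂ) * Complex.I)
        = (z.1 : ℂ) ^ 2 + (z.2 : ℂ) ^ 2 := by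
      simp only [star_add, star_mul', Complex.star_def, Complex.conj_ofReal, Complex.conj_I]
      linear_combination (-(z.2 : ℂ) ^ 2) * Complex.I_sq
    rw [← mul_pow, h]
    push_cast
    ring
  have I4 : Integrable (fun z : ℝ × ℝ => z.1 ^ 4 * z.2 ^ 0 + 2 * (z.1 ^ 2 * z.2 ^ 2))
      ((gaussianReal 0 (v / 2)).prod (gaussianReal 0 (v / 2))) :=
    (I' 4 0).add ((I' 2 2).const_mul 2)
  rw [this, integral_complex_ofReal, integral_add I4 (I' 0 4),
    integral_add (I' 4 0) ((I' 2 2).const_mul 2), integral_const_mul]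
  rw [integral_prod_mul (fun x : ℝ => x ^ 4) (fun x : ℝ => x ^ 0),
    integral_prod_mul (fun x : ℝ => x ^ 0) (fun x : ℝ => x ^ 4),
    integral_prod_mul (fun x : ℝ => x ^ 2) (fun x : ℝ => x ^ 2), integral_sq_gaussianReal,
    integral_pow_four_gaussianReal]
  simp
  ring

lemma isCircularLaw_complexNormal_one : IsCircularLaw (complexNormal 1) 0 := by
  intro a b ha hb
  refine ⟨integrable_mixed_complexNormal 1 a b, ?_⟩
  rcases eq_or_ne a b with rfl | hab
  · interval_cases a
    · simp [circularMoment]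
    · rw [integral_normSq_complexNormal]; simp [circularMoment]
    · rw [integral_normSq_sq_complexNormal]; simp [circularMoment]
  · rw [integral_mixed_complexNormal_of_ne 1 ha hb hab, circularMoment, if_neg hab]

/-- Dividing `𝒩_ℂ(0, v)` noise by its standard deviation gives a unit-variance circular
variable. -/
lemma isCircularLaw_complexNormal_map_inv_mul {v : ℝ} (hv : 0 < v) :
    IsCircularLaw ((complexNormal v.toNNReal).map
      fun z => ((Real.sqrt v : ℂ))⁻¹ * z) 0 := by
  have hs : (Real.sqrt v : ℂ) ≠ 0 := by
    exact_mod_cast (Real.sqrt_pos.mpr hv).ne'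
  have hsq : (Real.sqrt v : ℂ) ^ 2 = v := by
    rw [← Complex.ofReal_pow, Real.sq_sqrt hv.le]
  have hvc : (((v.toNNReal : ℝ≥0) : ℝ) : ℂ) = v := by rw [Real.coe_toNNReal _ hv.le]
  have hfun : ∀ a b : ℕ, (fun z : ℂ => star ((Real.sqrt v : ℂ)⁻¹ * z) ^ a
      * ((Real.sqrt v : ℂ)⁻¹ * z) ^ b)
      = fun z => ((Real.sqrt v : ℂ)⁻¹ ^ (a + b)) * (star z ^ a * z ^ b) := by
    intro a b; ext z
    have : star (Real.sqrt v : ℂ) = Real.sqrt v := Complex.conj_ofReal _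
    rw [star_mul', star_inv₀, this]
    ring
  intro a b ha hb
  rw [integrable_map_measure (by fun_prop) (by fun_prop),
    integral_map (by fun_prop) (by fun_prop), hfun]
  refine ⟨?_, ?_⟩
  · have := (integrable_mixed_complexNormal v.toNNReal a b).const_mul ((Real.sqrt v : ℂ)⁻¹ ^ (a + b))
    rw [← hfun] at this
    exact this
  rw [integral_const_mul]
  have hvne : (v : ℂ) ≠ 0 := by exact_mod_cast hv.ne'
  rcases eq_or_ne a b with rfl | hab
  · interval_cases a
    · simp [circularMoment]
    · rw [integral_normSq_complexNormal, hvc, inv_pow, hsq]; simp [circularMoment, hvne]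
    · rw [integral_normSq_sq_complexNormal, hvc, inv_pow,
        show (Real.sqrt v : ℂ) ^ (2 + 2) = (v : ℂ) ^ 2 by rw [← hsq]; ring]
      simp only [circularMoment, if_true]
      field_simp
      simp
  · rw [integral_mixed_complexNormal_of_ne _ ha hb hab, circularMoment, if_neg hab, mul_zero]

/-- A uniform phase is circular of unit modulus, so `E|z|⁴ = 1` and `κ = 1`. -/
lemma isCircularLaw_map_exp_uniform :
    IsCircularLaw ((ProbabilityTheory.cond volume (Set.Icc (-Real.pi) Real.pi)).map
      fun θ : ℝ => Complex.exp ((θ : ℂ) * Complex.I)) 1 := by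
  intro a b ha hb
  have hprob : IsProbabilityMeasure
      (ProbabilityTheory.cond (volume : Measure ℝ) (Set.Icc (-Real.pi) Real.pi)) := by
    refine cond_isProbabilityMeasure_of_finite ?_ ?_ <;> simp [Real.pi_pos]
  have hfun : (fun θ : ℝ => star (Complex.exp ((θ : ℂ) * Complex.I)) ^ a
      * Complex.exp ((θ : ℂ) * Complex.I) ^ b)
      = fun θ : ℝ => Complex.exp ((((b : ℂ) - a) * Complex.I) * θ) := by
    ext θ
    rw [Complex.star_def, ← Complex.exp_conj, ← Complex.exp_nat_mul, ← Complex.exp_nat_mul,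
      ← Complex.exp_add]
    congr 1
    simp
    ring
  rw [integrable_map_measure (by fun_prop) (by fun_prop),
    integral_map (by fun_prop) (by fun_prop)]
  refine ⟨?_, ?_⟩
  · refine (integrable_const (1 : ℝ)).mono' (by fun_prop) (ae_of_all _ fun θ => ?_)
    simp [Complex.norm_exp_ofReal_mul_I]
  rw [hfun]
  rcases eq_or_ne a b with rfl | hab
  · interval_cases a <;> norm_num [circularMoment]
  · have hc : ((b : ℂ) - a) * Complex.I ≠ 0 :=
      mul_ne_zero (sub_ne_zero.mpr (by exact_mod_cast hab.symm)) Complex.I_ne_zero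
    rw [circularMoment, if_neg hab, ProbabilityTheory.cond, integral_smul_measure,
      integral_Icc_eq_integral_Ioc,
      ← intervalIntegral.integral_of_le (by linarith [Real.pi_pos]),
      integral_exp_mul_complex hc]
    have : Complex.exp (((b : ℂ) - a) * Complex.I * (Real.pi : ℝ))
        = Complex.exp (((b : ℂ) - a) * Complex.I * ((-Real.pi : ℝ) : ℂ)) := by
      rw [Complex.exp_eq_exp_iff_exists_int]
      exact ⟨(b : ℤ) - a, by push_cast; ring⟩
    rw [this]; simp

/-! ### Second and fourth moments of bilinear forms in circular sources -/

section Forms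

variable {ι : Type*} {Ω' : Type*} [MeasurableSpace Ω']

/-- A finite family of complex random variables whose joint mixed moments, up to degree `(2, 2)` in
each variable, factor as for independent circular variables of unit variance. -/
def IsCircularFamily [Fintype ι] (P : Measure Ω') (ξ : ι → Ω' → ℂ) (κ : ι → ℂ) : Prop :=
  ∀ a b : ι → ℕ, (∀ r, a r ≤ 2) → (∀ r, b r ≤ 2) →
    Integrable (fun ω => ∏ r, star (ξ r ω) ^ a r * ξ r ω ^ b r) P ∧
      ∫ ω, ∏ r, star (ξ r ω) ^ a r * ξ r ω ^ b r ∂P = ∏ r, circularMoment (κ r) (a r) (b r)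

lemma form_eq_sum [Fintype ι] (P : Matrix ι ι ℂ) (x : ι → ℂ) :
    star x ⬝ᵥ (P *ᵥ x) = ∑ i, ∑ j, P i j * (star (x i) * x j) := by
  simp only [dotProduct, mulVec, Finset.mul_sum, Pi.star_apply]
  exact Finset.sum_congr rfl fun i _ => Finset.sum_congr rfl fun j _ => by ring

lemma star_form_mul_form_eq_sum [Fintype ι] (P Q : Matrix ι ι ℂ) (x : ι → ℂ) :
    star (star x ⬝ᵥ (P *ᵥ x)) * (star x ⬝ᵥ (Q *ᵥ x))
      = ∑ i, ∑ j, ∑ k, ∑ l, star (P i j) * Q k l *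
          (star (x j) * x i * star (x k) * x l) := by
  rw [form_eq_sum, form_eq_sum, star_sum, Finset.sum_mul]
  refine Finset.sum_congr rfl fun i _ => ?_
  rw [star_sum, Finset.sum_mul]
  refine Finset.sum_congr rfl fun j _ => ?_
  rw [Finset.mul_sum]
  refine Finset.sum_congr rfl fun k _ => ?_
  rw [Finset.mul_sum]
  refine Finset.sum_congr rfl fun l _ => ?_
  simp only [star_mul', star_star]
  ring

variable [DecidableEq ι]

/-- Exponents of the monomial `x_i x_k`. -/
def pairExponent (i k r : ι) : ℕ := (if r = i then 1 else 0) + (if r = k then 1 else 0)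

lemma pairExponent_le_two (i k r : ι) : pairExponent i k r ≤ 2 := by
  unfold pairExponent; split_ifs <;> norm_num

variable [Fintype ι]

lemma prod_pow_pairExponent (x : ι → ℂ) (i k : ι) :
    ∏ r, x r ^ pairExponent i k r = x i * x k := by
  simp only [pairExponent, pow_add, Finset.prod_mul_distrib]
  simp [pow_ite]

/-- Only the pairings of the conjugated with the unconjugated indices contribute; when all four
indices agree both pairings are counted, and `κ` corrects `2` to the true fourth moment. -/
lemma prod_circularMoment_pair (κ : ι → ℂ) (i j k l : ι) :
    ∏ r, circularMoment (κ r) (pairExponent i k r) (pairExponent j l r)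
      = (if i = j ∧ k = l then 1 else 0) + (if i = l ∧ k = j then 1 else 0)
        - (if i = j ∧ j = k ∧ k = l then κ i else 0) := by
  by_cases hik : i = k
  · subst hik
    by_cases hj : i = j
    · subst hj
      by_cases hl : i = l
      · subst hl
        rw [Finset.prod_eq_single i]
        · simp [circularMoment, pairExponent]; ring
        · intro r _ hr
          simp [circularMoment, pairExponent, hr]
        · simp
      · rw [Finset.prod_eq_zero (Finset.mem_univ i)]
        · simp [hl]
        · simp [circularMoment, pairExponent, hl]
    · rw [Finset.prod_eq_zero (Finset.mem_univ i)]
      · simp [hj]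
      · by_cases hl : i = l
        · subst hl
          simp [circularMoment, pairExponent, hj]
        · simp [circularMoment, pairExponent, hj, hl]
  · by_cases h1 : i = j ∧ k = l
    · obtain ⟨rfl, rfl⟩ := h1
      rw [Finset.prod_eq_one]
      · simp [hik]
      · intro r _
        have : pairExponent i k r ≠ 2 := by
          unfold pairExponent; split_ifs with h h' <;> simp_all
        simp [circularMoment, this]
    by_cases h2 : i = l ∧ k = j
    · obtain ⟨rfl, rfl⟩ := h2
      rw [Finset.prod_eq_one]
      · simp [hik]
      · intro r _
        have h : pairExponent i k r ≠ 2 := by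
          unfold pairExponent; split_ifs with h h' <;> simp_all
        have h' : pairExponent k i r = pairExponent i k r := by
          unfold pairExponent; ring
        simp [circularMoment, h, h']
    · have h3 : ¬ (i = j ∧ j = k ∧ k = l) := fun h => h1 ⟨h.1, h.2.2⟩
      rw [if_neg h1, if_neg h2, if_neg h3]
      by_cases hi : i ≠ j ∧ i ≠ l
      · rw [Finset.prod_eq_zero (Finset.mem_univ i)]
        · simp
        · simp [circularMoment, pairExponent, hik, hi.1, hi.2]
      by_cases hk : k ≠ j ∧ k ≠ l
      · rw [Finset.prod_eq_zero (Finset.mem_univ k)]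
        · simp
        · simp [circularMoment, pairExponent, Ne.symm hik, hk.1, hk.2]
      · exfalso
        grind

lemma IsCircularFamily.quartic {P : Measure Ω'} {ξ : ι → Ω' → ℂ} {κ : ι → ℂ}
    (h : IsCircularFamily P ξ κ) (i j k l : ι) :
    Integrable (fun ω => star (ξ i ω) * ξ j ω * star (ξ k ω) * ξ l ω) P ∧
      ∫ ω, star (ξ i ω) * ξ j ω * star (ξ k ω) * ξ l ω ∂P
        = (if i = j ∧ k = l then 1 else 0) + (if i = l ∧ k = j then 1 else 0)
          - (if i = j ∧ j = k ∧ k = l then κ i else 0) := by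
  have key := h (pairExponent i k) (pairExponent j l) (pairExponent_le_two i k)
    (pairExponent_le_two j l)
  have hfun : (fun ω => ∏ r, star (ξ r ω) ^ pairExponent i k r * ξ r ω ^ pairExponent j l r)
      = fun ω => star (ξ i ω) * ξ j ω * star (ξ k ω) * ξ l ω := by
    ext ω
    rw [Finset.prod_mul_distrib, prod_pow_pairExponent (fun r => star (ξ r ω)),
      prod_pow_pairExponent (fun r => ξ r ω)]
    ring
  rw [hfun, prod_circularMoment_pair] at key
  exact key

lemma IsCircularFamily.quadratic {P : Measure Ω'} {ξ : ι → Ω' → ℂ} {κ : ι → ℂ}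
    (h : IsCircularFamily P ξ κ) (i j : ι) :
    Integrable (fun ω => star (ξ i ω) * ξ j ω) P ∧
      ∫ ω, star (ξ i ω) * ξ j ω ∂P = if i = j then 1 else 0 := by
  have key := h (fun r => if r = i then 1 else 0) (fun r => if r = j then 1 else 0)
    (fun r => by split_ifs <;> norm_num) (fun r => by split_ifs <;> norm_num)
  have hfun : (fun ω => ∏ r, star (ξ r ω) ^ (if r = i then 1 else 0)
      * ξ r ω ^ (if r = j then 1 else 0)) = fun ω => star (ξ i ω) * ξ j ω := by
    ext ω
    rw [Finset.prod_mul_distrib]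
    simp [pow_ite]
  have hval : ∏ r, circularMoment (κ r) (if r = i then 1 else 0) (if r = j then 1 else 0)
      = if i = j then 1 else 0 := by
    split_ifs with hij
    · subst hij
      refine Finset.prod_eq_one fun r _ => ?_
      by_cases hr : r = i <;> simp [circularMoment, hr]
    · exact Finset.prod_eq_zero (Finset.mem_univ i) (by simp [circularMoment, hij])
  rw [hfun, hval] at key
  exact key

/-- `E[ξᴴ P ξ] = tr P`. -/
lemma IsCircularFamily.integral_form {P : Measure Ω'} {ξ : ι → Ω' → ℂ} {κ : ι → ℂ}
    (h : IsCircularFamily P ξ κ) (A : Matrix ι ι ℂ) :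
    Integrable (fun ω => star (fun r => ξ r ω) ⬝ᵥ (A *ᵥ fun r => ξ r ω)) P ∧
      ∫ ω, star (fun r => ξ r ω) ⬝ᵥ (A *ᵥ fun r => ξ r ω) ∂P = A.trace := by
  simp only [form_eq_sum]
  have hI : ∀ i j, Integrable (fun ω => A i j * (star (ξ i ω) * ξ j ω)) P :=
    fun i j => (h.quadratic i j).1.const_mul _
  refine ⟨integrable_finsetSum _ fun i _ => integrable_finsetSum _ fun j _ => hI i j, ?_⟩
  rw [integral_finsetSum _ fun i _ => integrable_finsetSum _ fun j _ => hI i j]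
  simp_rw [integral_finsetSum _ fun j _ => hI _ j, integral_const_mul, (h.quadratic _ _).2]
  simp [Matrix.trace]

/-- The fourth-moment identity
`E[(ξᴴ P ξ)^* (ξᴴ Q ξ)] = (tr P)^* tr Q + tr (Pᴴ Q) - ∑ κ_i P_{ii}^* Q_{ii}`. -/
lemma IsCircularFamily.integral_star_form_mul_form {μ : Measure Ω'} {ξ : ι → Ω' → ℂ} {κ : ι → ℂ}
    (h : IsCircularFamily μ ξ κ) (P Q : Matrix ι ι ℂ) :
    Integrable (fun ω => star (star (fun r => ξ r ω) ⬝ᵥ (P *ᵥ fun r => ξ r ω)) *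
        (star (fun r => ξ r ω) ⬝ᵥ (Q *ᵥ fun r => ξ r ω))) μ ∧
      ∫ ω, star (star (fun r => ξ r ω) ⬝ᵥ (P *ᵥ fun r => ξ r ω)) *
        (star (fun r => ξ r ω) ⬝ᵥ (Q *ᵥ fun r => ξ r ω)) ∂μ
        = star P.trace * Q.trace + (Pᴴ * Q).trace - ∑ i, κ i * (star (P i i) * Q i i) := by
  simp only [star_form_mul_form_eq_sum]
  have hI : ∀ i j k l, Integrable (fun ω => star (P i j) * Q k l *
      (star (ξ j ω) * ξ i ω * star (ξ k ω) * ξ l ω)) μ :=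
    fun i j k l => (h.quartic j i k l).1.const_mul _
  have hI1 : ∀ i j k, Integrable (fun ω => ∑ l, star (P i j) * Q k l *
      (star (ξ j ω) * ξ i ω * star (ξ k ω) * ξ l ω)) μ :=
    fun i j k => integrable_finsetSum _ fun l _ => hI i j k l
  have hI2 : ∀ i j, Integrable (fun ω => ∑ k, ∑ l, star (P i j) * Q k l *
      (star (ξ j ω) * ξ i ω * star (ξ k ω) * ξ l ω)) μ :=
    fun i j => integrable_finsetSum _ fun k _ => hI1 i j k
  have hI3 : ∀ i, Integrable (fun ω => ∑ j, ∑ k, ∑ l, star (P i j) * Q k l *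
      (star (ξ j ω) * ξ i ω * star (ξ k ω) * ξ l ω)) μ :=
    fun i => integrable_finsetSum _ fun j _ => hI2 i j
  refine ⟨integrable_finsetSum _ fun i _ => hI3 i, ?_⟩
  rw [integral_finsetSum _ fun i _ => hI3 i]
  simp_rw [integral_finsetSum _ fun j _ => hI2 _ j, integral_finsetSum _ fun k _ => hI1 _ _ k,
    integral_finsetSum _ fun l _ => hI _ _ _ l, integral_const_mul, (h.quartic _ _ _ _).2]
  simp only [mul_sub, mul_add, Finset.sum_sub_distrib, Finset.sum_add_distrib]
  congr 1
  · congr 1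
    · simp only [ite_and, mul_ite, mul_one, mul_zero, Finset.sum_ite_irrel, Finset.sum_ite_eq,
        Finset.sum_const_zero, Finset.mem_univ, if_true, Finset.sum_ite_eq']
      simp [Matrix.trace, Finset.sum_mul_sum]
    · simp only [ite_and, mul_ite, mul_one, mul_zero, Finset.sum_ite_eq, Finset.mem_univ, if_true,
        Finset.sum_ite_eq']
      rw [Matrix.trace, Finset.sum_comm]
      simp [Matrix.mul_apply]
  · simp only [ite_and, mul_ite, mul_zero, Finset.sum_ite_irrel, Finset.sum_ite_eq,
        Finset.sum_const_zero, Finset.mem_univ, if_true, Finset.sum_ite_eq']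
    exact Finset.sum_congr rfl fun i _ => by ring

end Forms

/-! ### Product constructions of circular families -/

section Products

variable {ι ι' : Type*} [Fintype ι] [Fintype ι'] {E F : Type*} [MeasurableSpace E]
  [MeasurableSpace F]

lemma IsCircularLaw.isCircularFamily_pi {ν : Measure E} [IsProbabilityMeasure ν] {f : E → ℂ}
    (hf : Measurable f) {κ : ℂ} (h : IsCircularLaw (ν.map f) κ) :
    IsCircularFamily (Measure.pi fun _ : ι => ν) (fun r x => f (x r)) (fun _ => κ) := by
  intro a b ha hb
  have hr := fun r => h (a r) (b r) (ha r) (hb r)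
  have hI : ∀ r, Integrable (fun x => star (f x) ^ a r * f x ^ b r) ν := fun r =>
    (integrable_map_measure (by fun_prop) (by fun_prop)).mp (hr r).1
  have hE : ∀ r, ∫ x, star (f x) ^ a r * f x ^ b r ∂ν = circularMoment κ (a r) (b r) := fun r => by
    rw [← (hr r).2, integral_map (by fun_prop) (by fun_prop)]
  refine ⟨Integrable.fintype_prod (f := fun r x => star (f x) ^ a r * f x ^ b r) hI, ?_⟩
  rw [integral_fintype_prod_eq_prod (fun r x => star (f x) ^ a r * f x ^ b r)]
  exact Finset.prod_congr rfl fun r _ => hE r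

lemma IsCircularFamily.pi {ν : Measure E} [IsProbabilityMeasure ν] {ξ : ι → E → ℂ} {κ : ι → ℂ}
    (h : IsCircularFamily ν ξ κ) :
    IsCircularFamily (Measure.pi fun _ : ι' => ν) (fun (r : ι × ι') x => ξ r.1 (x r.2))
      (fun r => κ r.1) := by
  intro a b ha hb
  have hi := fun i : ι' => h (fun r => a (r, i)) (fun r => b (r, i)) (fun r => ha _) (fun r => hb _)
  simp only [Fintype.prod_prod_type_right]
  refine ⟨Integrable.fintype_prod (f := fun (i : ι') x =>
    ∏ r, star (ξ r x) ^ a (r, i) * ξ r x ^ b (r, i)) fun i => (hi i).1, ?_⟩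
  rw [integral_fintype_prod_eq_prod
    (fun (i : ι') x => ∏ r, star (ξ r x) ^ a (r, i) * ξ r x ^ b (r, i))]
  exact Finset.prod_congr rfl fun i _ => (hi i).2

lemma IsCircularFamily.prod {P : Measure E} {Q : Measure F} [SFinite P] [SFinite Q]
    {ξ : ι → E → ℂ} {κ : ι → ℂ} (h : IsCircularFamily P ξ κ)
    {ξ' : ι' → F → ℂ} {κ' : ι' → ℂ} (h' : IsCircularFamily Q ξ' κ') :
    IsCircularFamily (P.prod Q)
      (fun r x => Sum.elim (fun i => ξ i x.1) (fun i => ξ' i x.2) r) (Sum.elim κ κ') := by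
  intro a b ha hb
  have h1 := h (fun i => a (Sum.inl i)) (fun i => b (Sum.inl i)) (fun _ => ha _) (fun _ => hb _)
  have h2 := h' (fun i => a (Sum.inr i)) (fun i => b (Sum.inr i)) (fun _ => ha _) (fun _ => hb _)
  simp only [Fintype.prod_sum_type, Sum.elim_inl, Sum.elim_inr]
  refine ⟨h1.1.mul_prod h2.1, ?_⟩
  rw [← h1.2, ← h2.2, ← integral_prod_mul]

end Products

/-! ### The joint law of the sources of randomness -/

/-- Index set of the scalar sources of randomness: the phases, the entries of the non-line-of-sight
components, and the entries of the pilot noise. -/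
abbrev SourceIndex (M N K τp : ℕ) : Type :=
  (Fin M × Fin K) ⊕ ((Fin N × (Fin M × Fin K)) ⊕ (Fin M × Fin N × Fin τp))

section Sources

variable {M N K τp : ℕ} {S : Network M N K τp} {Ω : Type*} [MeasurableSpace Ω] {μ : Measure Ω}

/-- All scalar sources of randomness, stacked in one vector; a phase `θ` enters as `e^{jθ}`. -/
noncomputable def Channel.source (C : Channel S μ) (ω : Ω) : SourceIndex M N K τp → ℂ :=
  Sum.elim (fun i => Complex.exp ((C.phase i.1 i.2 ω : ℂ) * Complex.I))
    (Sum.elim (fun a => C.nlos a.2.1 a.2.2 ω a.1) (fun j => C.noise j.1 j.2.1 j.2.2 ω))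

/-- The covariance matrix of the sources of randomness. -/
noncomputable def Network.sourceCov (S : Network M N K τp) :
    Matrix (SourceIndex M N K τp) (SourceIndex M N K τp) ℂ :=
  fromBlocks 1 0 0 (fromBlocks (blockDiagonal fun i => S.corr i.1 i.2) 0 0
    ((S.noisePower : ℂ) • 1))

/-- The sources of randomness are distributed as a linear image, block-diagonal and trivial on the
phases, of independent circular variables of unit variance. -/
lemma Channel.exists_circular_representation [IsProbabilityMeasure μ] (C : Channel S μ) :
    ∃ (P : Measure ((Fin M × Fin K → ℝ) × ((Fin M × Fin K → Fin N → ℂ) ×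
        (Fin M × Fin N × Fin τp → ℂ))))
      (ξ : SourceIndex M N K τp → _ → ℂ)
      (B : Matrix ((Fin N × (Fin M × Fin K)) ⊕ (Fin M × Fin N × Fin τp))
        ((Fin N × (Fin M × Fin K)) ⊕ (Fin M × Fin N × Fin τp)) ℂ),
      IsCircularFamily P ξ (Sum.elim (fun _ => 1) fun _ => 0) ∧
      (∀ r, Measurable (ξ r)) ∧
      (fromBlocks 1 0 0 B : Matrix (SourceIndex M N K τp) (SourceIndex M N K τp) ℂ) *
        (fromBlocks 1 0 0 B)ᴴ = S.sourceCov ∧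
      HasLaw C.source (P.map fun q => fromBlocks 1 0 0 B *ᵥ fun r => ξ r q) μ := by
  choose L hL hLaw using C.nlos_law
  have hσ := S.noisePower_pos
  set σ : ℂ := (Real.sqrt S.noisePower : ℂ) with hσdef
  have hσ0 : σ ≠ 0 := by
    rw [hσdef]; exact_mod_cast (Real.sqrt_pos.mpr hσ).ne'
  have hσsq : σ * star σ = S.noisePower := by
    rw [hσdef, Complex.star_def, Complex.conj_ofReal, ← Complex.ofReal_mul,
      Real.mul_self_sqrt hσ.le]
  set U : Measure ℝ := ProbabilityTheory.cond volume (Set.Icc (-Real.pi) Real.pi) with hU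
  have hUprob : IsProbabilityMeasure U := by
    refine cond_isProbabilityMeasure_of_finite ?_ ?_ <;> simp [Real.pi_pos]
  set G : Measure (Fin N → ℂ) := Measure.pi fun _ => complexNormal 1 with hG
  set Z : Measure ℂ := complexNormal S.noisePower.toNNReal with hZ
  let P := (Measure.pi fun _ : Fin M × Fin K => U).prod
    ((Measure.pi fun _ : Fin M × Fin K => G).prod (Measure.pi fun _ : Fin M × Fin N × Fin τp => Z))
  have hfG : IsCircularFamily G (fun r x => x r) (fun _ => 0) :=
    IsCircularLaw.isCircularFamily_pi (f := id) measurable_id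
      (by rw [Measure.map_id]; exact isCircularLaw_complexNormal_one)
  have hfam := (IsCircularLaw.isCircularFamily_pi (ι := Fin M × Fin K) (ν := U)
      (f := fun θ : ℝ => Complex.exp ((θ : ℂ) * Complex.I)) (by fun_prop)
      isCircularLaw_map_exp_uniform).prod
    ((hfG.pi (ι' := Fin M × Fin K)).prod (IsCircularLaw.isCircularFamily_pi
      (ι := Fin M × Fin N × Fin τp) (ν := Z) (f := fun z => σ⁻¹ * z) (by fun_prop)
      (isCircularLaw_complexNormal_map_inv_mul hσ)))
  refine ⟨P, fun r q => Sum.elim (fun i => Complex.exp ((q.1 i : ℂ) * Complex.I))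
      (fun r => Sum.elim (fun a => q.2.1 a.2 a.1) (fun j => σ⁻¹ * q.2.2 j) r) r,
    fromBlocks (blockDiagonal fun i => L i.1 i.2) 0 0 (σ • 1), ?_, ?_, ?_, ?_⟩
  · convert hfam using 1
    ext (i | a | j) <;> rfl
  · rintro (i | a | j) <;> simp only [Sum.elim_inl, Sum.elim_inr] <;> fun_prop
  · rw [Network.sourceCov, fromBlocks_conjTranspose, fromBlocks_multiply,
      fromBlocks_conjTranspose, fromBlocks_multiply]
    simp only [conjTranspose_one, conjTranspose_zero, Matrix.mul_one, Matrix.mul_zero,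
      Matrix.zero_mul, add_zero, zero_add, blockDiagonal_conjTranspose, ← blockDiagonal_mul, hL, conjTranspose_smul,
      smul_mul_smul_comm, hσsq]
  · have hphase : HasLaw (fun ω (i : Fin M × Fin K) => C.phase i.1 i.2 ω)
        (Measure.pi fun _ => U) μ :=
      C.phase_indep.hasLaw_pi fun i =>
        ⟨(C.phase_law i.1 i.2).aemeasurable (by simp [Real.pi_pos]) (by simp), C.phase_law i.1 i.2⟩
    have hnlos : HasLaw (fun ω (i : Fin M × Fin K) => C.nlos i.1 i.2 ω)
        (Measure.pi fun i : Fin M × Fin K => G.map fun w => L i.1 i.2 *ᵥ w) μ :=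
      C.nlos_indep.hasLaw_pi fun i => hLaw i.1 i.2
    have hnoise : HasLaw (fun ω (j : Fin M × Fin N × Fin τp) => C.noise j.1 j.2.1 j.2.2 ω)
        (Measure.pi fun _ => Z) μ :=
      C.noise_indep.hasLaw_pi fun j => C.noise_law j.1 j.2.1 j.2.2
    have hin : IndepFun (fun ω (i : Fin M × Fin K) => C.nlos i.1 i.2 ω)
        (fun ω (j : Fin M × Fin N × Fin τp) => C.noise j.1 j.2.1 j.2.2 ω) μ :=
      C.nlos_noise_indep.comp
        (φ := fun (x : Fin M → Fin K → Fin N → ℂ) (i : Fin M × Fin K) => x i.1 i.2)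
        (ψ := fun (x : Fin M → Fin N → Fin τp → ℂ) (j : Fin M × Fin N × Fin τp) =>
          x j.1 j.2.1 j.2.2) (by fun_prop) (by fun_prop)
    have hip : IndepFun (fun ω (i : Fin M × Fin K) => C.phase i.1 i.2 ω)
        (fun ω => ((fun (i : Fin M × Fin K) => C.nlos i.1 i.2 ω),
          (fun (j : Fin M × Fin N × Fin τp) => C.noise j.1 j.2.1 j.2.2 ω))) μ :=
      C.phase_nlos_noise_indep.comp
        (φ := fun (x : Fin M → Fin K → ℝ) (i : Fin M × Fin K) => x i.1 i.2)
        (ψ := fun x : (Fin M → Fin K → Fin N → ℂ) × (Fin M → Fin N → Fin τp → ℂ) =>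
          ((fun i : Fin M × Fin K => x.1 i.1 i.2),
            (fun j : Fin M × Fin N × Fin τp => x.2 j.1 j.2.1 j.2.2))) (by fun_prop) (by fun_prop)
    have hprob : ∀ i : Fin M × Fin K, IsProbabilityMeasure (G.map fun w => L i.1 i.2 *ᵥ w) :=
      fun i => Measure.isProbabilityMeasure_map (by fun_prop)
    have hjoint := hip.hasLaw_prod hphase (hin.hasLaw_prod hnlos hnoise)
    have hT : MeasurePreserving
        (Prod.map id (Prod.map (fun (w : Fin M × Fin K → Fin N → ℂ) i => L i.1 i.2 *ᵥ w i) id)) P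
        ((Measure.pi fun _ : Fin M × Fin K => U).prod
          ((Measure.pi fun i : Fin M × Fin K => G.map fun w => L i.1 i.2 *ᵥ w).prod
            (Measure.pi fun _ : Fin M × Fin N × Fin τp => Z))) := by
      have hpi : MeasurePreserving (fun (w : Fin M × Fin K → Fin N → ℂ) i => L i.1 i.2 *ᵥ w i)
          (Measure.pi fun _ => G) (Measure.pi fun i : Fin M × Fin K =>
            G.map fun w => L i.1 i.2 *ᵥ w) :=
        measurePreserving_pi _ _ fun i => ⟨by fun_prop, rfl⟩
      exact (MeasurePreserving.id _).prod (hpi.prod (MeasurePreserving.id _))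
    rw [← hT.map_eq] at hjoint
    let R : (Fin M × Fin K → ℝ) × ((Fin M × Fin K → Fin N → ℂ) × (Fin M × Fin N × Fin τp → ℂ)) →
        SourceIndex M N K τp → ℂ := fun q =>
      Sum.elim (fun i => Complex.exp ((q.1 i : ℂ) * Complex.I))
        (Sum.elim (fun a => q.2.1 a.2 a.1) (fun j => q.2.2 j))
    have hR : Measurable R := by
      refine measurable_pi_lambda _ ?_
      rintro (i | a | j) <;> simp only [R, Sum.elim_inl, Sum.elim_inr] <;> fun_prop
    have hRlaw := HasLaw.comp (Y := R) ⟨hR.aemeasurable, rfl⟩ hjoint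
    rw [Measure.map_map hR hT.measurable] at hRlaw
    refine ⟨hRlaw.aemeasurable, hRlaw.map_eq.trans ?_⟩
    congr 1
    symm
    ext q r
    rw [fromBlocks_mulVec]
    rcases r with i | r
    · simp [R, Function.comp_def]
    · simp only [Sum.elim_inr, zero_mulVec, zero_add, fromBlocks_mulVec]
      rcases r with a | j
      · simp [R, Function.comp_def, mulVec, dotProduct, Fintype.sum_prod_type_right,
          blockDiagonal_apply]
      · simp [R, Function.comp_def, smul_mulVec, hσ0]

/-- `E[ρᴴ A ρ] = tr (A Σ)` for the source vector `ρ` with covariance matrix `Σ`. -/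
lemma Channel.integral_source_form [IsProbabilityMeasure μ] (C : Channel S μ)
    (A : Matrix (SourceIndex M N K τp) (SourceIndex M N K τp) ℂ) :
    Integrable (fun ω => star (C.source ω) ⬝ᵥ (A *ᵥ C.source ω)) μ ∧
      ∫ ω, star (C.source ω) ⬝ᵥ (A *ᵥ C.source ω) ∂μ = (A * S.sourceCov).trace := by
  obtain ⟨P, ξ, B, hξ, hm, hB, hlaw⟩ := C.exists_circular_representation
  set Λ : Matrix (SourceIndex M N K τp) (SourceIndex M N K τp) ℂ := fromBlocks 1 0 0 B
  have hF : Measurable fun x : SourceIndex M N K τp → ℂ => star x ⬝ᵥ (A *ᵥ x) := by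
    unfold dotProduct mulVec dotProduct; simp only [Pi.star_apply]; fun_prop
  have hΛ : Measurable fun q => Λ *ᵥ fun r => ξ r q := by
    unfold mulVec dotProduct; fun_prop
  have hpull : ∀ q, star (Λ *ᵥ fun r => ξ r q) ⬝ᵥ (A *ᵥ (Λ *ᵥ fun r => ξ r q))
      = star (fun r => ξ r q) ⬝ᵥ ((Λᴴ * A * Λ) *ᵥ fun r => ξ r q) := fun q => by
    rw [star_mulVec, ← dotProduct_mulVec, mulVec_mulVec, mulVec_mulVec, Matrix.mul_assoc]
  have key := hξ.integral_form (Λᴴ * A * Λ)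
  simp only [← hpull] at key
  constructor
  · have h1 : Integrable (fun x => star x ⬝ᵥ (A *ᵥ x)) (μ.map C.source) := by
      rw [hlaw.map_eq, integrable_map_measure hF.aestronglyMeasurable hΛ.aemeasurable]
      exact key.1
    exact (integrable_map_measure hF.aestronglyMeasurable hlaw.aemeasurable).mp h1
  · have h1 := integral_map hlaw.aemeasurable (f := fun x => star x ⬝ᵥ (A *ᵥ x))
      hF.aestronglyMeasurable
    rw [← h1, hlaw.map_eq, integral_map hΛ.aemeasurable hF.aestronglyMeasurable, key.2, ← hB,
      Matrix.trace_mul_comm, ← Matrix.mul_assoc, Matrix.trace_mul_comm]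

/-- Fourth-order moments of the sources of randomness. The last sum is the correction for the
phases, which have constant modulus and hence a smaller fourth moment than Gaussian variables. -/
lemma Channel.integral_star_source_form_mul [IsProbabilityMeasure μ] (C : Channel S μ)
    (A A' : Matrix (SourceIndex M N K τp) (SourceIndex M N K τp) ℂ) :
    Integrable (fun ω => star (star (C.source ω) ⬝ᵥ (A *ᵥ C.source ω)) *
        (star (C.source ω) ⬝ᵥ (A' *ᵥ C.source ω))) μ ∧
      ∫ ω, star (star (C.source ω) ⬝ᵥ (A *ᵥ C.source ω)) *
        (star (C.source ω) ⬝ᵥ (A' *ᵥ C.source ω)) ∂μ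
        = star (A * S.sourceCov).trace * (A' * S.sourceCov).trace
          + (Aᴴ * S.sourceCov * A' * S.sourceCov).trace
          - ∑ i, star (A (Sum.inl i) (Sum.inl i)) * A' (Sum.inl i) (Sum.inl i) := by
  obtain ⟨P, ξ, B, hξ, hm, hB, hlaw⟩ := C.exists_circular_representation
  set Λ : Matrix (SourceIndex M N K τp) (SourceIndex M N K τp) ℂ := fromBlocks 1 0 0 B with hΛdef
  have hF : Measurable fun x : SourceIndex M N K τp → ℂ =>
      star (star x ⬝ᵥ (A *ᵥ x)) * (star x ⬝ᵥ (A' *ᵥ x)) := by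
    unfold dotProduct mulVec dotProduct; simp only [Pi.star_apply]; fun_prop
  have hΛ : Measurable fun q => Λ *ᵥ fun r => ξ r q := by
    unfold mulVec dotProduct; fun_prop
  have hpull : ∀ (D : Matrix (SourceIndex M N K τp) (SourceIndex M N K τp) ℂ) q,
      star (fun r => ξ r q) ⬝ᵥ ((Λᴴ * D * Λ) *ᵥ fun r => ξ r q)
      = star (Λ *ᵥ fun r => ξ r q) ⬝ᵥ (D *ᵥ (Λ *ᵥ fun r => ξ r q)) := fun D q => by
    rw [star_mulVec, ← dotProduct_mulVec, mulVec_mulVec, mulVec_mulVec, Matrix.mul_assoc]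
  have hdiag : ∀ (D : Matrix (SourceIndex M N K τp) (SourceIndex M N K τp) ℂ) i,
      (Λᴴ * D * Λ) (Sum.inl i) (Sum.inl i) = D (Sum.inl i) (Sum.inl i) := fun D i => by
    rw [hΛdef, ← fromBlocks_toBlocks D, fromBlocks_conjTranspose, fromBlocks_multiply,
      fromBlocks_multiply]
    simp
  have htr : ∀ D : Matrix (SourceIndex M N K τp) (SourceIndex M N K τp) ℂ,
      (Λᴴ * D * Λ).trace = (D * S.sourceCov).trace := fun D => by
    rw [← hB, Matrix.mul_assoc, Matrix.trace_mul_comm, Matrix.mul_assoc]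
  have htr' : ((Λᴴ * A * Λ)ᴴ * (Λᴴ * A' * Λ)).trace
      = (Aᴴ * S.sourceCov * A' * S.sourceCov).trace := by
    rw [← hB]
    simp only [conjTranspose_mul, conjTranspose_conjTranspose, Matrix.mul_assoc]
    rw [Matrix.trace_mul_comm]
    simp only [Matrix.mul_assoc]
  have key := hξ.integral_star_form_mul_form (Λᴴ * A * Λ) (Λᴴ * A' * Λ)
  simp only [hpull, htr, htr', Fintype.sum_sum_type, Sum.elim_inl, Sum.elim_inr, hdiag, one_mul,
    zero_mul, Finset.sum_const_zero, add_zero] at key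
  constructor
  · have h1 : Integrable (fun x => star (star x ⬝ᵥ (A *ᵥ x)) * (star x ⬝ᵥ (A' *ᵥ x)))
        (μ.map C.source) := by
      rw [hlaw.map_eq, integrable_map_measure hF.aestronglyMeasurable hΛ.aemeasurable]
      exact key.1
    exact (integrable_map_measure hF.aestronglyMeasurable hlaw.aemeasurable).mp h1
  · have h1 := integral_map hlaw.aemeasurable
      (f := fun x => star (star x ⬝ᵥ (A *ᵥ x)) * (star x ⬝ᵥ (A' *ᵥ x))) hF.aestronglyMeasurable
    rw [← h1, hlaw.map_eq, integral_map hΛ.aemeasurable hF.aestronglyMeasurable, key.2]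

end Sources

/-! ### The channels and their estimates as linear images of the sources -/

section Coefficients

variable {M N K τp : ℕ} (S : Network M N K τp)

/-- Coefficients of `ḡ_{ml} e^{jθ_{ml}}` in terms of the phases. -/
def Network.losCoeff (m : Fin M) (l : Fin K) : Matrix (Fin N) (Fin M × Fin K) ℂ :=
  Matrix.of fun n i => if i = (m, l) then S.los m l n else 0

/-- The matrix that selects `ǧ_{ml}` among the entries of all non-line-of-sight components. -/
def nlosSelect (N : ℕ) {M K : ℕ} (m : Fin M) (l : Fin K) :
    Matrix (Fin N) (Fin N × (Fin M × Fin K)) ℂ :=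
  Matrix.of fun n a => if a = (n, (m, l)) then 1 else 0

/-- The matrix that maps the entries of all noise matrices to `N_m^p φ`. -/
def noiseSelect (N : ℕ) {M τp : ℕ} (m : Fin M) (φ : Fin τp → ℂ) :
    Matrix (Fin N) (Fin M × Fin N × Fin τp) ℂ :=
  Matrix.of fun n j => if j.1 = m ∧ j.2.1 = n then φ j.2.2 else 0

/-- Coefficients of the channel `g_{ml}` in terms of the sources. -/
def Network.channelCoeff (m : Fin M) (l : Fin K) : Matrix (Fin N) (SourceIndex M N K τp) ℂ :=
  fromCols (S.losCoeff m l) (fromCols (nlosSelect N m l) 0)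

/-- Coefficients of the innovation `y_{mk}^p - ȳ_{mk}^p` in terms of the sources. -/
noncomputable def Network.innovationCoeff (m : Fin M) (k : Fin K) :
    Matrix (Fin N) ((Fin N × (Fin M × Fin K)) ⊕ (Fin M × Fin N × Fin τp)) ℂ :=
  fromCols (∑ l ∈ S.sharing k, ((Real.sqrt (S.power l) : ℂ) * (τp : ℂ)) • nlosSelect N m l)
    (noiseSelect N m (star (S.pilot (S.pilotIndex k))))

/-- Coefficients of the estimate `ĝ_{mk}` in terms of the sources. -/
noncomputable def Network.estimateCoeff (m : Fin M) (k : Fin K) :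
    Matrix (Fin N) (SourceIndex M N K τp) ℂ :=
  fromCols (S.losCoeff m k)
    ((Real.sqrt (S.power k) : ℂ) • (S.corr m k * (S.Psi m k)⁻¹) * S.innovationCoeff m k)

section Random

variable {S} {Ω : Type*} [MeasurableSpace Ω] {μ : Measure Ω} (C : Channel S μ)

lemma Channel.losPart_eq_mulVec (m : Fin M) (l : Fin K) (ω : Ω) :
    C.losPart m l ω = S.losCoeff m l *ᵥ
      fun i => Complex.exp ((C.phase i.1 i.2 ω : ℂ) * Complex.I) := by
  ext n
  simp [Channel.losPart, Network.losCoeff, mulVec, dotProduct, mul_comm]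

lemma Channel.nlos_eq_mulVec (m : Fin M) (l : Fin K) (ω : Ω) :
    C.nlos m l ω = nlosSelect N m l *ᵥ fun a => C.nlos a.2.1 a.2.2 ω a.1 := by
  ext n
  simp [nlosSelect, mulVec, dotProduct]

lemma Channel.noise_mulVec (m : Fin M) (φ : Fin τp → ℂ) (ω : Ω) :
    (Matrix.of fun n s => C.noise m n s ω) *ᵥ φ
      = noiseSelect N m φ *ᵥ fun j => C.noise j.1 j.2.1 j.2.2 ω := by
  ext n
  simp only [noiseSelect, mulVec, dotProduct, of_apply, Fintype.sum_prod_type, ite_mul, zero_mul,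
    ite_and]
  simp [Finset.sum_ite_irrel, mul_comm]

lemma Channel.g_eq_mulVec (m : Fin M) (l : Fin K) (ω : Ω) :
    C.g m l ω = S.channelCoeff m l *ᵥ C.source ω := by
  rw [Network.channelCoeff, Channel.source, fromCols_mulVec_sumElim, fromCols_mulVec_sumElim,
    zero_mulVec, add_zero, ← C.losPart_eq_mulVec, ← C.nlos_eq_mulVec]
  rfl

lemma Channel.y_sub_ybar (m : Fin M) (k : Fin K) (ω : Ω) :
    C.y m k ω - C.ybar m k ω
      = (∑ l ∈ S.sharing k, ((Real.sqrt (S.power l) : ℂ) * (τp : ℂ)) • C.nlos m l ω)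
        + (Matrix.of fun n s => C.noise m n s ω) *ᵥ star (S.pilot (S.pilotIndex k)) := by
  have h : (∑ l : Fin K, (Real.sqrt (S.power l) : ℂ) •
      vecMulVec (C.g m l ω) (S.pilot (S.pilotIndex l))) *ᵥ star (S.pilot (S.pilotIndex k))
      = ∑ l ∈ S.sharing k, ((Real.sqrt (S.power l) : ℂ) * (τp : ℂ)) • C.g m l ω := by
    rw [sum_mulVec, Network.sharing, Finset.sum_filter]
    refine Finset.sum_congr rfl fun l _ => ?_
    rw [smul_mulVec, vecMulVec_mulVec, S.pilot_orthogonal]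
    split_ifs with hl
    · ext n; simp; ring
    · simp
  rw [Channel.y, Channel.receivedPilot, add_mulVec, h, Channel.ybar]
  simp only [Channel.g, smul_add, Finset.sum_add_distrib]
  abel

lemma Channel.y_sub_ybar_eq_mulVec (m : Fin M) (k : Fin K) (ω : Ω) :
    C.y m k ω - C.ybar m k ω = S.innovationCoeff m k *ᵥ
      Sum.elim (fun a => C.nlos a.2.1 a.2.2 ω a.1) (fun j => C.noise j.1 j.2.1 j.2.2 ω) := by
  rw [C.y_sub_ybar, Network.innovationCoeff, fromCols_mulVec_sumElim, C.noise_mulVec, sum_mulVec]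
  simp only [smul_mulVec, ← C.nlos_eq_mulVec]

lemma Channel.ghat_eq_mulVec (m : Fin M) (k : Fin K) (ω : Ω) :
    C.ghat m k ω = S.estimateCoeff m k *ᵥ C.source ω := by
  rw [Network.estimateCoeff, Channel.source, fromCols_mulVec_sumElim, ← mulVec_mulVec,
    ← C.y_sub_ybar_eq_mulVec, ← C.losPart_eq_mulVec, smul_mulVec]
  rfl

end Random

/-! ### Covariances of the channels and their estimates -/

/-- The covariance matrix of all non-line-of-sight components, stacked in one vector. -/
def Network.corrBlocks :
    Matrix (Fin N × (Fin M × Fin K)) (Fin N × (Fin M × Fin K)) ℂ :=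
  blockDiagonal fun i => S.corr i.1 i.2

lemma Network.fromCols_mul_sourceCov_mul (A A' : Matrix (Fin N) (Fin M × Fin K) ℂ)
    (B B' : Matrix (Fin N) (Fin N × (Fin M × Fin K)) ℂ)
    (D D' : Matrix (Fin N) (Fin M × Fin N × Fin τp) ℂ) :
    fromCols A (fromCols B D) * S.sourceCov * (fromCols A' (fromCols B' D'))ᴴ
      = A * A'ᴴ + (B * S.corrBlocks * B'ᴴ
        + (S.noisePower : ℂ) • (D * D'ᴴ)) := by
  rw [Network.sourceCov, conjTranspose_fromCols_eq_fromRows_conjTranspose,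
    conjTranspose_fromCols_eq_fromRows_conjTranspose, fromCols_mul_fromBlocks,
    Matrix.mul_one, Matrix.mul_zero, Matrix.mul_zero, add_zero, zero_add, fromCols_mul_fromBlocks,
    Matrix.mul_zero, Matrix.mul_zero, add_zero, zero_add, fromCols_mul_fromRows,
    fromCols_mul_fromRows, Matrix.mul_smul, Matrix.mul_one, Matrix.smul_mul, Network.corrBlocks]

lemma Network.losCoeff_mul_conjTranspose (m m' : Fin M) (l l' : Fin K) :
    S.losCoeff m l * (S.losCoeff m' l')ᴴ = if m = m' ∧ l = l' then S.G m l else 0 := by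
  ext n n'
  by_cases h : m = m' ∧ l = l'
  · obtain ⟨rfl, rfl⟩ := h
    simp [Network.losCoeff, Matrix.mul_apply, Network.G, vecMulVec_apply]
  · have h' : ¬ ((m, l) = (m', l')) := by simpa using h
    simp [Network.losCoeff, Matrix.mul_apply, h, h']

lemma nlosSelect_mul_mul (m m' : Fin M) (l l' : Fin K)
    (X : Matrix (Fin N × (Fin M × Fin K)) (Fin N × (Fin M × Fin K)) ℂ) :
    nlosSelect N m l * X * (nlosSelect N m' l')ᴴ
      = Matrix.of fun n n' => X (n, (m, l)) (n', (m', l')) := by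
  have h : nlosSelect N m l * X = Matrix.of fun n b => X (n, (m, l)) b := by
    ext n b; simp [nlosSelect, Matrix.mul_apply]
  rw [h]
  ext n n'
  simp [nlosSelect, Matrix.mul_apply]

lemma Network.nlosSelect_mul_corr_mul (m m' : Fin M) (l l' : Fin K) :
    nlosSelect N m l * S.corrBlocks * (nlosSelect N m' l')ᴴ
      = if m = m' ∧ l = l' then S.corr m l else 0 := by
  rw [nlosSelect_mul_mul]
  ext n n'
  by_cases h : m = m' ∧ l = l' <;> simp [Network.corrBlocks, blockDiagonal_apply, h]

lemma noiseSelect_mul_conjTranspose (m m' : Fin M) (φ : Fin τp → ℂ) :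
    noiseSelect N m φ * (noiseSelect N m' φ)ᴴ
      = if m = m' then (φ ⬝ᵥ star φ) • (1 : Matrix (Fin N) (Fin N) ℂ) else 0 := by
  ext n n'
  simp only [noiseSelect, Matrix.mul_apply, of_apply, conjTranspose_apply, Fintype.sum_prod_type,
    ite_and]
  by_cases h : m = m'
  · subst h
    by_cases hn : n = n'
    · subst hn
      simp [Finset.sum_ite_irrel, dotProduct]
    · simp [Finset.sum_ite_irrel, hn]
  · simp [Finset.sum_ite_irrel, h]

lemma Network.channelCoeff_cov (m m' : Fin M) (l l' : Fin K) :
    S.channelCoeff m l * S.sourceCov * (S.channelCoeff m' l')ᴴ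
      = if m = m' ∧ l = l' then S.G m l + S.corr m l else 0 := by
  rw [Network.channelCoeff, Network.channelCoeff, S.fromCols_mul_sourceCov_mul,
    S.losCoeff_mul_conjTranspose, S.nlosSelect_mul_corr_mul, Matrix.zero_mul, smul_zero, add_zero]
  split_ifs <;> simp

lemma Network.Psi_posDef (m : Fin M) (k : Fin K) : (S.Psi m k).PosDef := by
  refine PosDef.posSemidef_add (posSemidef_sum _ fun l _ => (S.corr_posSemidef m l).smul ?_)
    (PosDef.one.smul ?_)
  · rw [← Complex.ofReal_natCast, ← Complex.ofReal_mul, Complex.zero_le_real]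
    exact mul_nonneg (S.power_nonneg l) (Nat.cast_nonneg _)
  · exact Complex.zero_lt_real.mpr S.noisePower_pos

lemma Network.sqrt_power_mul_self (l : Fin K) :
    (Real.sqrt (S.power l) : ℂ) * Real.sqrt (S.power l) = S.power l := by
  rw [← Complex.ofReal_mul, Real.mul_self_sqrt (S.power_nonneg l)]

lemma star_ofReal_complex (x : ℝ) : star (x : ℂ) = x := Complex.conj_ofReal x

/-- The innovations have covariance `τ_p Ψ_{mk}` and are uncorrelated between APs. -/
lemma Network.innovationCoeff_cov (m m' : Fin M) (k : Fin K) :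
    S.innovationCoeff m k * (fromBlocks S.corrBlocks 0 0 ((S.noisePower : ℂ) • 1) :
        Matrix ((Fin N × (Fin M × Fin K)) ⊕ (Fin M × Fin N × Fin τp))
          ((Fin N × (Fin M × Fin K)) ⊕ (Fin M × Fin N × Fin τp)) ℂ) * (S.innovationCoeff m' k)ᴴ
      = if m = m' then (τp : ℂ) • S.Psi m k else 0 := by
  have hpilot : star (S.pilot (S.pilotIndex k)) ⬝ᵥ star (star (S.pilot (S.pilotIndex k)))
      = (τp : ℂ) := by
    rw [star_star, dotProduct_comm, S.pilot_orthogonal, if_pos rfl]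
  rw [Network.innovationCoeff, Network.innovationCoeff,
    conjTranspose_fromCols_eq_fromRows_conjTranspose, fromCols_mul_fromBlocks, Matrix.mul_zero,
    Matrix.mul_zero, add_zero, zero_add, fromCols_mul_fromRows, Matrix.mul_smul, Matrix.mul_one,
    Matrix.smul_mul, noiseSelect_mul_conjTranspose, hpilot]
  simp only [conjTranspose_sum, conjTranspose_smul, Matrix.sum_mul, Matrix.mul_sum, Matrix.smul_mul,
    Matrix.mul_smul, S.nlosSelect_mul_corr_mul, star_mul', star_ofReal_complex, star_natCast]
  by_cases h : m = m'
  · subst h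
    simp only [true_and, if_true, smul_ite, smul_zero, Finset.sum_ite_eq']
    rw [Network.Psi, smul_add, Finset.smul_sum, smul_smul, smul_smul, mul_comm (τp : ℂ)]
    congr 1
    refine Finset.sum_congr rfl fun l hl => ?_
    rw [if_pos hl, smul_smul, smul_smul, ← S.sqrt_power_mul_self]
    congr 1; ring
  · simp [h]

/-- `E[ĝ_{mk} ĝ_{m'k}ᴴ]`. -/
lemma Network.estimateCoeff_cov (m m' : Fin M) (k : Fin K) :
    S.estimateCoeff m k * S.sourceCov * (S.estimateCoeff m' k)ᴴ
      = if m = m' then S.Rbar m k else 0 := by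
  rw [Network.estimateCoeff, Network.estimateCoeff,
    conjTranspose_fromCols_eq_fromRows_conjTranspose, Network.sourceCov, fromCols_mul_fromBlocks,
    Matrix.mul_one, Matrix.mul_zero, Matrix.mul_zero, add_zero, zero_add, fromCols_mul_fromRows,
    S.losCoeff_mul_conjTranspose, conjTranspose_mul, Matrix.mul_assoc, Matrix.mul_assoc,
    ← Matrix.mul_assoc (S.innovationCoeff m k), ← Matrix.mul_assoc (_ * _) (S.innovationCoeff m' k)ᴴ]
  rw [show (blockDiagonal fun i : Fin M × Fin K => S.corr i.1 i.2) = S.corrBlocks from rfl,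
    S.innovationCoeff_cov]
  by_cases h : m = m'
  · subst h
    -- in `Ř Ψ⁻¹ (τ_p Ψ) Ψ⁻¹ Ř` one factor `Ψ⁻¹` cancels
    have hu : IsUnit (S.Psi m k).det := (Matrix.isUnit_iff_isUnit_det _).mp (S.Psi_posDef m k).isUnit
    simp only [and_self, if_true, conjTranspose_smul, conjTranspose_mul, conjTranspose_nonsing_inv,
      (S.Psi_posDef m k).isHermitian.eq, (S.corr_posSemidef m k).isHermitian.eq, Matrix.smul_mul,
      Matrix.mul_smul, star_ofReal_complex, smul_smul, Network.Rbar]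
    congr 1
    rw [Matrix.mul_assoc, ← Matrix.mul_assoc (S.Psi m k), Matrix.mul_nonsing_inv _ hu,
      Matrix.one_mul, ← Matrix.mul_assoc, ← S.sqrt_power_mul_self]
    congr 1; ring
  · simp [h]

/-- `E[g_{ml} ĝ_{mk}ᴴ]`. -/
lemma Network.channelCoeff_mul_estimateCoeff (m : Fin M) (l k : Fin K) :
    S.channelCoeff m l * S.sourceCov * (S.estimateCoeff m k)ᴴ
      = if l ∈ S.sharing k then S.B m l k else 0 := by
  have hsqrt : (Real.sqrt (S.power k * S.power l) : ℂ)
      = Real.sqrt (S.power k) * Real.sqrt (S.power l) := by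
    rw [Real.sqrt_mul (S.power_nonneg k), Complex.ofReal_mul]
  rw [Network.channelCoeff, Network.estimateCoeff, Network.innovationCoeff, mul_fromCols,
    S.fromCols_mul_sourceCov_mul, S.losCoeff_mul_conjTranspose, Matrix.zero_mul, smul_zero,
    add_zero, conjTranspose_mul, ← Matrix.mul_assoc]
  simp only [conjTranspose_sum, conjTranspose_smul, Matrix.mul_sum, Matrix.mul_smul,
    S.nlosSelect_mul_corr_mul, star_mul', star_ofReal_complex, star_natCast, true_and, smul_ite,
    smul_zero, Finset.sum_ite_eq, conjTranspose_mul, conjTranspose_nonsing_inv,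
      (S.Psi_posDef m k).isHermitian.eq, (S.corr_posSemidef m k).isHermitian.eq]
  by_cases hl : l ∈ S.sharing k
  · have hG : (if l = k then S.G m l else 0) = if l = k then S.G m k else 0 := by
      split_ifs with h
      · rw [h]
      · rfl
    simp only [hl, if_true, Network.B, hsqrt, Matrix.smul_mul, smul_smul,
      mul_assoc, hG]
  · have hlk : l ≠ k := by
      rintro rfl; exact hl (by simp [Network.sharing])
    simp [hl, hlk]

lemma Network.Psi_eq_of_mem_sharing (m : Fin M) {l k : Fin K} (h : l ∈ S.sharing k) :
    S.Psi m l = S.Psi m k := by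
  have h' : S.pilotIndex l = S.pilotIndex k := by simpa [Network.sharing] using h
  simp only [Network.Psi, Network.sharing, h']

lemma Network.B_conjTranspose (m : Fin M) {l k : Fin K} (h : l ∈ S.sharing k) :
    (S.B m l k)ᴴ = S.B m k l := by
  have hG : (S.G m k)ᴴ = S.G m k := by
    simp [Network.G, conjTranspose_vecMulVec]
  have hite : (if l = k then S.G m k else 0 : Matrix (Fin N) (Fin N) ℂ)ᴴ
      = if k = l then S.G m l else 0 := by
    by_cases hlk : l = k
    · subst hlk; simp [hG]
    · simp [hlk, Ne.symm hlk]
  rw [Network.B, Network.B, conjTranspose_add, hite, conjTranspose_smul, conjTranspose_mul,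
    conjTranspose_mul, conjTranspose_nonsing_inv, (S.Psi_posDef m k).isHermitian.eq,
    (S.corr_posSemidef m k).isHermitian.eq, (S.corr_posSemidef m l).isHermitian.eq,
    S.Psi_eq_of_mem_sharing m h, star_mul', star_ofReal_complex, star_natCast,
    mul_comm (S.power k), Matrix.mul_assoc]

end Coefficients

/-! ### Closed forms of the expectations -/

section Expectations

variable {M N K τp : ℕ} (S : Network M N K τp) (W : Fin M → Fin K → Matrix (Fin N) (Fin N) ℂ)

/-- The matrix of the sesquilinear form in the sources that represents `v_{mk}ᴴ g_{ml}`. -/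
noncomputable def Network.effForm (m : Fin M) (k l : Fin K) :
    Matrix (SourceIndex M N K τp) (SourceIndex M N K τp) ℂ :=
  (W m k * S.estimateCoeff m k)ᴴ * S.channelCoeff m l

lemma Network.trace_effForm_mul_sourceCov (m : Fin M) (k l : Fin K) :
    (S.effForm W m k l * S.sourceCov).trace
      = if l ∈ S.sharing k then ((W m k)ᴴ * S.B m l k).trace else 0 := by
  rw [Network.effForm, conjTranspose_mul, Matrix.mul_assoc, Matrix.mul_assoc, Matrix.trace_mul_comm,
    Matrix.mul_assoc, S.channelCoeff_mul_estimateCoeff]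
  split_ifs <;> simp

lemma Network.B_self (m : Fin M) (k : Fin K) : S.B m k k = S.Rbar m k := by
  rw [Network.B, Network.Rbar, if_pos rfl, Real.sqrt_mul_self (S.power_nonneg k)]

lemma Network.mem_sharing_self (k : Fin K) : k ∈ S.sharing k := by simp [Network.sharing]

lemma Network.trace_effForm_mul_effForm (m n : Fin M) (k l : Fin K) :
    ((S.effForm W m k l)ᴴ * S.sourceCov * S.effForm W n k l * S.sourceCov).trace
      = if m = n then S.phi W m k l else 0 := by
  have h : ((S.effForm W m k l)ᴴ * S.sourceCov * S.effForm W n k l * S.sourceCov).trace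
      = (W m k * (S.estimateCoeff m k * S.sourceCov * (S.estimateCoeff n k)ᴴ) * (W n k)ᴴ
        * (S.channelCoeff n l * S.sourceCov * (S.channelCoeff m l)ᴴ)).trace := by
    simp only [Network.effForm, conjTranspose_mul, conjTranspose_conjTranspose, Matrix.mul_assoc]
    rw [Matrix.trace_mul_comm]
    simp only [Matrix.mul_assoc]
  rw [h, S.estimateCoeff_cov, S.channelCoeff_cov]
  by_cases hmn : m = n
  · subst hmn
    have hcyc : ∀ X Y : Matrix (Fin N) (Fin N) ℂ, (W m k * X * (W m k)ᴴ * Y).trace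
        = ((W m k)ᴴ * Y * W m k * X).trace := fun X Y => by
      rw [Matrix.mul_assoc (W m k * X), Matrix.trace_mul_comm, ← Matrix.mul_assoc]
    simp only [and_self, if_true]
    rw [hcyc, Network.phi, Network.Rhat, Network.Rbar]
    simp only [Matrix.mul_add, Matrix.add_mul, Matrix.trace_add]
    ring
  · simp [hmn]

/-- The diagonal entry at a phase is non-zero only if both the combiner and the channel contain
this phase. -/
lemma Network.effForm_inl_inl (m : Fin M) (k l : Fin K) (i : Fin M × Fin K) :
    S.effForm W m k l (Sum.inl i) (Sum.inl i)
      = if i = (m, k) ∧ l = k then ((W m k)ᴴ * S.G m k).trace else 0 := by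
  have h1 : S.effForm W m k l (Sum.inl i) (Sum.inl i)
      = ((W m k * S.losCoeff m k)ᴴ * S.losCoeff m l) i i := by
    rw [Network.effForm, Network.estimateCoeff, Network.channelCoeff, mul_fromCols (W m k),
      conjTranspose_fromCols_eq_fromRows_conjTranspose, fromRows_mul_fromCols,
      fromBlocks_apply₁₁]
  rw [h1, Matrix.mul_apply]
  by_cases hi : i = (m, k) ∧ l = k
  · obtain ⟨rfl, rfl⟩ := hi
    simp [Network.losCoeff, Matrix.mul_apply, Network.G, vecMulVec_apply, Matrix.trace,
      Finset.sum_mul]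
    rw [Finset.sum_comm]
    exact Finset.sum_congr rfl fun _ _ => Finset.sum_congr rfl fun _ _ => by ring
  · rw [if_neg hi]
    refine Finset.sum_eq_zero fun n _ => ?_
    by_cases hk : i = (m, k)
    · have hl : l ≠ k := fun h => hi ⟨hk, h⟩
      simp [Network.losCoeff, hk, Ne.symm hl]
    · simp [Network.losCoeff, Matrix.mul_apply, hk]

/-- The correction for the constant modulus of the phases. -/
lemma Network.sum_effForm_inl (m n : Fin M) (k l : Fin K) :
    ∑ i, star (S.effForm W m k l (Sum.inl i) (Sum.inl i)) * S.effForm W n k l (Sum.inl i) (Sum.inl i)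
      = if m = n ∧ l = k then
          star ((W m k)ᴴ * S.G m k).trace * ((W m k)ᴴ * S.G m k).trace else 0 := by
  simp only [S.effForm_inl_inl]
  by_cases hl : l = k
  · subst hl
    by_cases hmn : m = n
    · subst hmn; simp
    · simp only [and_true, hmn, if_false]
      refine Finset.sum_eq_zero fun i _ => ?_
      by_cases hi : i = (m, l)
      · have : i ≠ (n, l) := by rw [hi]; simpa using hmn
        simp [this]
      · simp [hi]
  · simp [hl]

lemma Network.upsilon_eq (m : Fin M) {k l : Fin K} :
    S.upsilon W m k l = star ((W m k)ᴴ * S.B m l k).trace * ((W m k)ᴴ * S.B m l k).trace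
      - if l = k then star ((W m k)ᴴ * S.G m k).trace * ((W m k)ᴴ * S.G m k).trace else 0 := by
  set T := ((W m k)ᴴ * S.corr m l * (S.Psi m k)⁻¹ * S.corr m k).trace with hT
  have hsq : (Real.sqrt (S.power k * S.power l) : ℂ) * Real.sqrt (S.power k * S.power l)
      = S.power k * S.power l := by
    rw [← Complex.ofReal_mul, Real.mul_self_sqrt (mul_nonneg (S.power_nonneg k) (S.power_nonneg l)),
      Complex.ofReal_mul]
  have hB : ((W m k)ᴴ * S.B m l k).trace = (if l = k then ((W m k)ᴴ * S.G m k).trace else 0)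
      + (Real.sqrt (S.power k * S.power l) : ℂ) * τp * T := by
    rw [Network.B, Matrix.mul_add, Matrix.trace_add, Matrix.mul_smul, Matrix.trace_smul, smul_eq_mul,
      hT, Matrix.mul_assoc _ (S.corr m l), Matrix.mul_assoc _ (S.corr m l * _)]
    congr 1
    split_ifs <;> simp
  have hnorm : ((‖T‖ ^ 2 : ℝ) : ℂ) = star T * T := by
    rw [Complex.star_def, mul_comm, Complex.mul_conj, Complex.normSq_eq_norm_sq]
  rw [Network.upsilon, hB, ← hT, hnorm]
  by_cases hl : l = k
  · subst hl
    have hG : star ((W m l)ᴴ * S.G m l).trace = (W m l * S.G m l).trace := by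
      have : (S.G m l)ᴴ = S.G m l := by simp [Network.G, conjTranspose_vecMulVec]
      rw [← Matrix.trace_conjTranspose, conjTranspose_mul, conjTranspose_conjTranspose, this,
        Matrix.trace_mul_comm]
    have hTs : (W m l * S.corr m l * (S.Psi m l)⁻¹ * S.corr m l).trace = star T := by
      rw [hT, ← Matrix.trace_conjTranspose]
      simp only [conjTranspose_mul, conjTranspose_conjTranspose, conjTranspose_nonsing_inv,
        (S.Psi_posDef m l).isHermitian.eq, (S.corr_posSemidef m l).isHermitian.eq]
      rw [Matrix.mul_assoc, Matrix.mul_assoc, Matrix.trace_mul_comm]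
      simp only [Matrix.mul_assoc]
    rw [Real.sqrt_mul_self (S.power_nonneg l), if_pos rfl, if_pos rfl, if_pos rfl, hTs, ← hG]
    simp only [star_add, star_mul', star_ofReal_complex, star_natCast]
    ring
  · simp only [hl, if_false, add_zero, zero_add, sub_zero, star_mul', star_ofReal_complex,
      star_natCast]
    linear_combination (-(τp : ℂ) ^ 2 * (star T * T)) * hsq

end Expectations

section Integrals

variable {M N K τp : ℕ} {S : Network M N K τp} {Ω : Type*} [MeasurableSpace Ω] {μ : Measure Ω}
  (C : Channel S μ) (W : Fin M → Fin K → Matrix (Fin N) (Fin N) ℂ)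

lemma star_mulVec_dotProduct_mulVec {n p : Type*} [Fintype n] [Fintype p] (A B : Matrix n p ℂ)
    (x : p → ℂ) : star (A *ᵥ x) ⬝ᵥ (B *ᵥ x) = star x ⬝ᵥ ((Aᴴ * B) *ᵥ x) := by
  rw [star_mulVec, ← dotProduct_mulVec, mulVec_mulVec]

lemma Channel.eff_eq_form (m : Fin M) (k l : Fin K) (ω : Ω) :
    C.eff W m k l ω = star (C.source ω) ⬝ᵥ (S.effForm W m k l *ᵥ C.source ω) := by
  rw [Channel.eff, Channel.v, C.ghat_eq_mulVec, C.g_eq_mulVec, mulVec_mulVec,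
    star_mulVec_dotProduct_mulVec, Network.effForm]

lemma Channel.vNormSq_eq_form (m : Fin M) (k : Fin K) (ω : Ω) :
    (C.vNormSq W m k ω : ℂ) = star (C.source ω) ⬝ᵥ
      (((W m k * S.estimateCoeff m k)ᴴ * (W m k * S.estimateCoeff m k)) *ᵥ C.source ω) := by
  rw [← star_mulVec_dotProduct_mulVec, ← mulVec_mulVec, ← C.ghat_eq_mulVec, Channel.vNormSq,
    Complex.ofReal_sum]
  refine Finset.sum_congr rfl fun n _ => ?_
  rw [Pi.star_apply, Complex.star_def, mul_comm, Complex.mul_conj, Complex.normSq_eq_norm_sq]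
  rfl

variable [IsProbabilityMeasure μ]

lemma Channel.integrable_eff (m : Fin M) (k l : Fin K) : Integrable (C.eff W m k l) μ :=
  (C.integral_source_form (S.effForm W m k l)).1.congr
    (ae_of_all _ fun ω => (C.eff_eq_form W m k l ω).symm)

lemma Channel.integral_eff (m : Fin M) (k l : Fin K) :
    ∫ ω, C.eff W m k l ω ∂μ = if l ∈ S.sharing k then ((W m k)ᴴ * S.B m l k).trace else 0 := by
  simp only [C.eff_eq_form, (C.integral_source_form _).2, S.trace_effForm_mul_sourceCov]

lemma Channel.integrable_star_eff_mul_eff (n m : Fin M) (k l : Fin K) :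
    Integrable (fun ω => star (C.eff W m k l ω) * C.eff W n k l ω) μ := by
  simp only [C.eff_eq_form]
  exact (C.integral_star_source_form_mul _ _).1

lemma Channel.meanB_eq_bBar (k : Fin K) : C.meanB W k = S.bBar W k := by
  ext m
  rw [Channel.meanB, C.integral_eff, if_pos (S.mem_sharing_self k), S.B_self, Network.bBar]

lemma Channel.Xi_eq_XiBar (k l : Fin K) : C.Xi W k l = S.XiBar W k l := by
  ext n m
  simp only [Channel.Xi, Network.XiBar, of_apply, C.eff_eq_form]
  rw [(C.integral_star_source_form_mul _ _).2, S.trace_effForm_mul_sourceCov,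
    S.trace_effForm_mul_sourceCov, S.trace_effForm_mul_effForm, S.sum_effForm_inl]
  by_cases hl : l ∈ S.sharing k
  · simp only [if_pos hl]
    by_cases hmn : m = n
    · subst hmn
      simp only [if_true, true_and, S.upsilon_eq]
      ring
    · simp only [hmn, if_false, false_and, add_zero, sub_zero]
      rw [← S.B_conjTranspose m hl, ← Matrix.trace_conjTranspose, conjTranspose_mul,
        conjTranspose_conjTranspose, Matrix.trace_mul_comm]
  · have hlk : l ≠ k := by
      rintro rfl; exact hl (S.mem_sharing_self l)
    simp [hl, hlk]

lemma Channel.integrable_vNormSq (m : Fin M) (k : Fin K) : Integrable (C.vNormSq W m k) μ := by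
  have h := (C.integral_source_form
    ((W m k * S.estimateCoeff m k)ᴴ * (W m k * S.estimateCoeff m k))).1
  simp only [← C.vNormSq_eq_form] at h
  exact h.re

lemma Channel.integral_vNormSq (m : Fin M) (k : Fin K) :
    ((∫ ω, C.vNormSq W m k ω ∂μ : ℝ) : ℂ) = (W m k * S.Rbar m k * (W m k)ᴴ).trace := by
  rw [← integral_complex_ofReal]
  simp only [C.vNormSq_eq_form, (C.integral_source_form _).2]
  have hcov := S.estimateCoeff_cov m m k
  rw [if_pos rfl] at hcov
  rw [← hcov, conjTranspose_mul, Matrix.mul_assoc, Matrix.mul_assoc, Matrix.trace_mul_comm,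
    Matrix.mul_assoc, Matrix.trace_mul_comm]
  simp only [Matrix.mul_assoc]

lemma Channel.D_eq_DBar (k : Fin K) : C.D W k = S.DBar W k := by
  rw [Channel.D, Network.DBar]
  congr 1; ext m
  exact C.integral_vNormSq W m k

end Integrals

/-! ### Second-moment matrices and the matrix in the denominator -/

lemma posSemidef_secondMoment {M : ℕ} {Ω : Type*} [MeasurableSpace Ω] {μ : Measure Ω}
    {e : Fin M → Ω → ℂ} (he : ∀ n m, Integrable (fun ω => star (e m ω) * e n ω) μ) :
    (Matrix.of fun n m => ∫ ω, star (e m ω) * e n ω ∂μ : Matrix (Fin M) (Fin M) ℂ).PosSemidef := by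
  refine PosSemidef.of_dotProduct_mulVec_nonneg ?_ fun x => ?_
  · ext n m
    rw [conjTranspose_apply, of_apply, of_apply, Complex.star_def, ← integral_conj]
    congr 1; ext ω
    simp [mul_comm]
  · have hI : ∀ n m, Integrable (fun ω => star (x n) * x m * (star (e m ω) * e n ω)) μ :=
      fun n m => (he n m).const_mul _
    have hform : star x ⬝ᵥ ((Matrix.of fun n m => ∫ ω, star (e m ω) * e n ω ∂μ) *ᵥ x)
        = ∫ ω, ((‖∑ n, star (x n) * e n ω‖ ^ 2 : ℝ) : ℂ) ∂μ := by
      have hsq : ∀ ω, ((‖∑ n, star (x n) * e n ω‖ ^ 2 : ℝ) : ℂ)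
          = ∑ n, ∑ m, star (x n) * x m * (star (e m ω) * e n ω) := fun ω => by
        rw [← Complex.normSq_eq_norm_sq, ← Complex.mul_conj, map_sum, Finset.sum_mul_sum]
        refine Finset.sum_congr rfl fun n _ => Finset.sum_congr rfl fun m _ => ?_
        simp; ring
      simp only [hsq]
      rw [integral_finsetSum _ fun n _ => integrable_finsetSum _ fun m _ => hI n m]
      simp_rw [integral_finsetSum _ fun m _ => hI _ m, integral_const_mul]
      simp only [dotProduct, mulVec, Finset.mul_sum, of_apply, Pi.star_apply]
      exact Finset.sum_congr rfl fun n _ => Finset.sum_congr rfl fun m _ => by ring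
    rw [hform, integral_complex_ofReal, Complex.zero_le_real]
    exact integral_nonneg fun ω => by positivity

lemma posSemidef_centredSecondMoment {M : ℕ} {Ω : Type*} [MeasurableSpace Ω] {μ : Measure Ω}
    [IsProbabilityMeasure μ] {e : Fin M → Ω → ℂ} (he1 : ∀ m, Integrable (e m) μ)
    (he : ∀ n m, Integrable (fun ω => star (e m ω) * e n ω) μ) :
    ((Matrix.of fun n m => ∫ ω, star (e m ω) * e n ω ∂μ : Matrix (Fin M) (Fin M) ℂ)
      - vecMulVec (fun m => ∫ ω, e m ω ∂μ) (star fun m => ∫ ω, e m ω ∂μ)).PosSemidef := by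
  set b : Fin M → ℂ := fun m => ∫ ω, e m ω ∂μ with hb
  have hstar : ∀ m, Integrable (fun ω => star (e m ω)) μ := fun m =>
    Complex.conjCLE.toContinuousLinearMap.integrable_comp (he1 m)
  have hexp : ∀ n m, (fun ω => star (e m ω - b m) * (e n ω - b n)) = fun ω =>
      star (e m ω) * e n ω - star (e m ω) * b n - (star (b m) * e n ω - star (b m) * b n) := by
    intro n m; ext ω; rw [star_sub]; ring
  have i1 : ∀ n m, Integrable (fun ω => star (e m ω) * e n ω - star (e m ω) * b n) μ :=
    fun n m => (he n m).sub ((hstar m).mul_const _)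
  have i2 : ∀ n m, Integrable (fun ω => star (b m) * e n ω - star (b m) * b n) μ :=
    fun n m => ((he1 n).const_mul _).sub (integrable_const _)
  have hcI : ∀ n m, Integrable (fun ω => star (e m ω - b m) * (e n ω - b n)) μ := fun n m => by
    rw [hexp]; exact (i1 n m).sub (i2 n m)
  have key := posSemidef_secondMoment hcI
  convert key using 1
  ext n m
  rw [Matrix.sub_apply, of_apply, of_apply, vecMulVec_apply, hexp, integral_sub (i1 n m) (i2 n m),
    integral_sub (he n m) ((hstar m).mul_const _), integral_sub ((he1 n).const_mul _)
      (integrable_const _), integral_mul_const, integral_const_mul, Pi.star_apply]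
  have : ∫ ω, star (e m ω) ∂μ = star (b m) := integral_conj
  rw [this]
  simp [hb]
  ring

section Denominator

variable {M N K τp : ℕ} {S : Network M N K τp} {Ω : Type*} [MeasurableSpace Ω] {μ : Measure Ω}
  [IsProbabilityMeasure μ] (W : Fin M → Fin K → Matrix (Fin N) (Fin N) ℂ)

lemma Channel.lsfdMatrix_eq_bar (C : Channel S μ) (k : Fin K) :
    S.lsfdMatrix k (C.meanB W k) (C.Xi W k) (C.D W k) = S.lsfdMatrixBar W k := by
  rw [Network.lsfdMatrixBar, C.meanB_eq_bBar, C.D_eq_DBar, funext (C.Xi_eq_XiBar W k)]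

/-- The interference part of the denominator: the channel covariance of UE `k` itself and the
second moments of the other UEs. -/
lemma Channel.posSemidef_interference (C : Channel S μ) (k : Fin K) :
    ((∑ l : Fin K, (S.power l : ℂ) • C.Xi W k l)
      - (S.power k : ℂ) • vecMulVec (C.meanB W k) (star (C.meanB W k))).PosSemidef := by
  have hp : ∀ l, (0 : ℂ) ≤ S.power l := fun l => Complex.zero_le_real.mpr (S.power_nonneg l)
  rw [← Finset.add_sum_erase _ _ (Finset.mem_univ k), add_sub_right_comm, ← smul_sub]
  refine PosSemidef.add (PosSemidef.smul ?_ (hp k))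
    (posSemidef_sum _ fun l _ => PosSemidef.smul ?_ (hp l))
  · exact posSemidef_centredSecondMoment (fun m => C.integrable_eff W m k k)
      (fun n m => C.integrable_star_eff_mul_eff W n m k k)
  · exact posSemidef_secondMoment (fun n m => C.integrable_star_eff_mul_eff W n m k l)

lemma Channel.posSemidef_lsfdMatrixBar (C : Channel S μ) (k : Fin K) :
    (S.lsfdMatrixBar W k).PosSemidef := by
  rw [← C.lsfdMatrix_eq_bar, Network.lsfdMatrix]
  refine (C.posSemidef_interference W k).add (PosSemidef.smul ?_
    (Complex.zero_le_real.mpr S.noisePower_pos.le))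
  refine posSemidef_diagonal_iff.mpr fun m => Complex.zero_le_real.mpr (integral_nonneg fun ω => ?_)
  exact Finset.sum_nonneg fun n _ => by positivity

lemma Channel.posDef_lsfdMatrixBar (C : Channel S μ) (k : Fin K)
    (h : ∀ m, (W m k * S.Rbar m k * (W m k)ᴴ).trace ≠ 0) : (S.lsfdMatrixBar W k).PosDef := by
  rw [← C.lsfdMatrix_eq_bar, Network.lsfdMatrix]
  refine PosDef.posSemidef_add (C.posSemidef_interference W k) (PosDef.smul ?_
    (Complex.zero_lt_real.mpr S.noisePower_pos))
  refine posDef_diagonal_iff.mpr fun m => Complex.zero_lt_real.mpr (lt_of_le_of_ne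
    (integral_nonneg fun ω => Finset.sum_nonneg fun n _ => by positivity) fun h0 => h m ?_)
  rw [← C.integral_vNormSq, ← h0, Complex.ofReal_zero]

/-- If `tr (W R̄ Wᴴ) = 0` at AP `m`, the combining vector vanishes almost surely, and with it the
`m`-th column of the matrix in the denominator. -/
lemma Channel.trace_ne_zero_of_isUnit (C : Channel S μ) (k : Fin K)
    (h : IsUnit (S.lsfdMatrixBar W k)) (m : Fin M) :
    (W m k * S.Rbar m k * (W m k)ᴴ).trace ≠ 0 := by
  intro h0
  have hint : ∫ ω, C.vNormSq W m k ω ∂μ = 0 := by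
    have := C.integral_vNormSq W m k
    rw [h0] at this; exact_mod_cast this
  have hv : ∀ᵐ ω ∂μ, C.v W m k ω = 0 := by
    have hz := (integral_eq_zero_iff_of_nonneg
      (fun ω => Finset.sum_nonneg fun n _ => by positivity) (C.integrable_vNormSq W m k)).mp hint
    filter_upwards [hz] with ω hω
    ext n
    have := (Finset.sum_eq_zero_iff_of_nonneg fun n _ => by positivity).mp hω n (Finset.mem_univ n)
    simpa using this
  have heff : ∀ l, ∀ᵐ ω ∂μ, C.eff W m k l ω = 0 := fun l => by
    filter_upwards [hv] with ω hω
    simp [Channel.eff, hω]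
  have hmean : C.meanB W k m = 0 := by
    rw [Channel.meanB, integral_eq_zero_of_ae (heff k)]
  have hXi : ∀ l n, C.Xi W k l n m = 0 := fun l n => by
    rw [Channel.Xi, of_apply]
    refine integral_eq_zero_of_ae ?_
    filter_upwards [heff l] with ω hω
    simp [hω]
  have hD : ∀ n, C.D W k n m = 0 := fun n => by
    rw [Channel.D]
    by_cases hn : n = m
    · subst hn; simp [hint]
    · simp [hn]
  have hdet := (Matrix.isUnit_iff_isUnit_det _).mp h
  rw [← C.lsfdMatrix_eq_bar, Matrix.det_eq_zero_of_column_eq_zero m] at hdet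
  · simp at hdet
  · intro n
    rw [Network.lsfdMatrix, Matrix.add_apply, Matrix.sub_apply, Matrix.sum_apply]
    simp [hXi, hmean, hD, vecMulVec_apply]

end Denominator

/-! ### Maximization of the generalized Rayleigh quotient -/

section Rayleigh

variable {n : Type*} [Fintype n] [DecidableEq n] {A : Matrix n n ℂ}

/-- The Cauchy–Schwarz inequality for the inner product given by `A`, applied to `a` and
`A⁻¹ b`. -/
lemma norm_dotProduct_sq_le (hA : A.PosDef) (a b : n → ℂ) (ha : a ≠ 0) :
    ‖star a ⬝ᵥ b‖ ^ 2 ≤ (star a ⬝ᵥ (A *ᵥ a)).re * (star b ⬝ᵥ (A⁻¹ *ᵥ b)).re := by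
  have hpos : 0 < star a ⬝ᵥ (A *ᵥ a) := hA.dotProduct_mulVec_pos ha
  have hq : 0 ≤ star b ⬝ᵥ (A⁻¹ *ᵥ b) := hA.inv.posSemidef.dotProduct_mulVec_nonneg b
  set x := A⁻¹ *ᵥ b with hx
  set r := star a ⬝ᵥ (A *ᵥ a) with hr
  set q := star b ⬝ᵥ x with hqdef
  set s := star a ⬝ᵥ b with hs
  have hAx : A *ᵥ x = b := by
    rw [hx, mulVec_mulVec, Matrix.mul_nonsing_inv _ ((Matrix.isUnit_iff_isUnit_det _).mp hA.isUnit),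
      one_mulVec]
  have hqs : star x ⬝ᵥ b = q := by
    have h : star q = star x ⬝ᵥ b := by rw [hqdef, star_dotProduct, star_star]
    rw [← h, (IsSelfAdjoint.of_nonneg hq).star_eq]
  have hxa : star x ⬝ᵥ (A *ᵥ a) = star s := by
    have h : star x ᵥ* A = star b := by rw [← hAx, star_mulVec A x, hA.isHermitian.eq]
    rw [dotProduct_mulVec, h, hs, star_dotProduct]
  have hrs : star r = r := (IsSelfAdjoint.of_nonneg hpos.le).star_eq
  -- `r • x - s • a` is `r` times the component of `x` that is `A`-orthogonal to `a`
  have h0 := hA.posSemidef.dotProduct_mulVec_nonneg (r • x - s • a)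
  have hexp : star (r • x - s • a) ⬝ᵥ (A *ᵥ (r • x - s • a)) = r * (r * q - s * star s) := by
    rw [mulVec_sub, mulVec_smul, mulVec_smul, hAx, star_sub, star_smul, star_smul]
    simp only [sub_dotProduct, dotProduct_sub, smul_dotProduct, dotProduct_smul, smul_eq_mul, hqs,
      hxa, ← hr, ← hs, hrs]
    ring
  rw [hexp] at h0
  have hrre : r = (r.re : ℂ) := Complex.ext rfl (by simpa using (Complex.pos_iff.mp hpos).2.symm)
  have hqre : q = (q.re : ℂ) := Complex.ext rfl (by simpa using (Complex.nonneg_iff.mp hq).2.symm)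
  have hss : s * star s = ((‖s‖ ^ 2 : ℝ) : ℂ) := by
    rw [Complex.star_def, Complex.mul_conj, Complex.normSq_eq_norm_sq]
  rw [hss, hrre, hqre, ← Complex.ofReal_mul, ← Complex.ofReal_sub, ← Complex.ofReal_mul,
    Complex.zero_le_real] at h0
  have hr0 : 0 < r.re := (Complex.pos_iff.mp hpos).1
  have := nonneg_of_mul_nonneg_right h0 hr0
  linarith

/-- The weighted quotient `p |aᴴ b|² / (aᴴ A a)` has maximum `p bᴴ A⁻¹ b`, attained at
`A⁻¹ b`. -/
lemma isGreatest_rayleigh [Nonempty n] (hA : A.PosDef) (b : n → ℂ) {p : ℝ} (hp : 0 ≤ p) :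
    ∃ q : ℝ, (q : ℂ) = (p : ℂ) * (star b ⬝ᵥ (A⁻¹ *ᵥ b)) ∧
      IsGreatest ((fun a => p * ‖star a ⬝ᵥ b‖ ^ 2 / (star a ⬝ᵥ (A *ᵥ a)).re) ''
        {a : n → ℂ | a ≠ 0}) q ∧
      (b ≠ 0 → A⁻¹ *ᵥ b ≠ 0 ∧
        p * ‖star (A⁻¹ *ᵥ b) ⬝ᵥ b‖ ^ 2 / (star (A⁻¹ *ᵥ b) ⬝ᵥ (A *ᵥ (A⁻¹ *ᵥ b))).re = q) := by
  have hq : 0 ≤ star b ⬝ᵥ (A⁻¹ *ᵥ b) := hA.inv.posSemidef.dotProduct_mulVec_nonneg b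
  have hAx : A *ᵥ (A⁻¹ *ᵥ b) = b := by
    rw [mulVec_mulVec, Matrix.mul_nonsing_inv _ ((Matrix.isUnit_iff_isUnit_det _).mp hA.isUnit),
      one_mulVec]
  have hqs : star (A⁻¹ *ᵥ b) ⬝ᵥ b = star b ⬝ᵥ (A⁻¹ *ᵥ b) := by
    rw [star_mulVec, ← dotProduct_mulVec, hA.inv.isHermitian.eq]
  have hqre : star b ⬝ᵥ (A⁻¹ *ᵥ b) = ((star b ⬝ᵥ (A⁻¹ *ᵥ b)).re : ℂ) :=
    Complex.ext rfl (by simpa using (Complex.nonneg_iff.mp hq).2.symm)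
  have hattain : b ≠ 0 → A⁻¹ *ᵥ b ≠ 0 ∧
      p * ‖star (A⁻¹ *ᵥ b) ⬝ᵥ b‖ ^ 2 / (star (A⁻¹ *ᵥ b) ⬝ᵥ (A *ᵥ (A⁻¹ *ᵥ b))).re
        = p * (star b ⬝ᵥ (A⁻¹ *ᵥ b)).re := by
    intro hb
    have hqpos : 0 < (star b ⬝ᵥ (A⁻¹ *ᵥ b)).re :=
      (Complex.pos_iff.mp (hA.inv.dotProduct_mulVec_pos hb)).1
    refine ⟨fun h => hb ?_, ?_⟩
    · rw [← hAx, h, mulVec_zero]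
    · rw [hAx, hqs, hqre, Complex.norm_real, Real.norm_of_nonneg hqpos.le, Complex.ofReal_re]
      field_simp
  refine ⟨p * (star b ⬝ᵥ (A⁻¹ *ᵥ b)).re, ?_, ⟨?_, ?_⟩, hattain⟩
  · rw [Complex.ofReal_mul, ← hqre]
  · by_cases hb : b = 0
    · -- the quotient is identically zero, and any nonzero vector attains the maximum
      refine ⟨1, one_ne_zero, ?_⟩
      simp [hb]
    · exact ⟨_, (hattain hb).1, (hattain hb).2⟩
  · rintro _ ⟨a, ha, rfl⟩
    have hpos : 0 < (star a ⬝ᵥ (A *ᵥ a)).re :=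
      (Complex.pos_iff.mp (hA.dotProduct_mulVec_pos ha)).1
    rw [div_le_iff₀ hpos]
    nlinarith [mul_le_mul_of_nonneg_left (norm_dotProduct_sq_le hA a b ha) hp]

end Rayleigh

end CellFree

theorem theorem2 {M N K τp : ℕ} (hM : 0 < M) (S : CellFree.Network M N K τp)
    {Ω : Type*} [MeasurableSpace Ω] (μ : MeasureTheory.Measure Ω)
    [MeasureTheory.IsProbabilityMeasure μ] (C : CellFree.Channel S μ)
    (W : Fin M → Fin K → Matrix (Fin N) (Fin N) ℂ) (k : Fin K) :
    -- all expectations in the spectral efficiency exist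
    ((∀ m, MeasureTheory.Integrable (C.eff W m k k) μ) ∧
      (∀ l n m, MeasureTheory.Integrable
        (fun ω => star (C.eff W m k l ω) * C.eff W n k l ω) μ) ∧
      (∀ m, MeasureTheory.Integrable (C.vNormSq W m k) μ)) ∧
    -- their closed forms
    C.meanB W k = S.bBar W k ∧
    C.D W k = S.DBar W k ∧
    (∀ l, C.Xi W k l = S.XiBar W k l) ∧
    -- the quadratic form in the denominator is real and nonnegative
    (S.lsfdMatrixBar W k).PosSemidef ∧
    -- closed form of the spectral efficiency, for every weight vector
    (∀ a : Fin M → ℂ, C.SINR W k a = S.SINRBar W k a ∧ C.SE W k a = S.SEBar W k a) ∧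
    -- the inverse exists exactly when no combining vector vanishes almost surely
    (IsUnit (S.lsfdMatrixBar W k) ↔
      ∀ m, (W m k * S.Rbar m k * (W m k)ᴴ).trace ≠ 0) ∧
    -- optimal weights and maximum SINR
    S.lsfdWeights k (C.meanB W k) (C.Xi W k) (C.D W k) = S.aBar W k ∧
    (IsUnit (S.lsfdMatrixBar W k) →
      (S.lsfdMatrixBar W k).PosDef ∧
      ∃ sinrMax : ℝ,
        (sinrMax : ℂ) = (S.power k : ℂ) * (star (S.bBar W k) ⬝ᵥ S.aBar W k) ∧
        IsGreatest (C.SINR W k '' {a : Fin M → ℂ | a ≠ 0}) sinrMax ∧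
        (S.bBar W k ≠ 0 → S.aBar W k ≠ 0 ∧ C.SINR W k (S.aBar W k) = sinrMax)) := by
  have hXi := funext (C.Xi_eq_XiBar W k)
  have hSINR : ∀ a, C.SINR W k a = S.SINRBar W k a := fun a => by
    rw [CellFree.Channel.SINR, CellFree.Network.SINRBar, C.meanB_eq_bBar, C.D_eq_DBar, hXi]
  have hPosDef : IsUnit (S.lsfdMatrixBar W k) → (S.lsfdMatrixBar W k).PosDef := fun h =>
    C.posDef_lsfdMatrixBar W k (C.trace_ne_zero_of_isUnit W k h)
  refine ⟨⟨fun m => C.integrable_eff W m k k,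
      fun l n m => C.integrable_star_eff_mul_eff W n m k l, fun m => C.integrable_vNormSq W m k⟩,
    C.meanB_eq_bBar W k, C.D_eq_DBar W k, C.Xi_eq_XiBar W k, C.posSemidef_lsfdMatrixBar W k,
    fun a => ⟨hSINR a, by rw [CellFree.Channel.SE, CellFree.Network.SEBar, hSINR]⟩,
    ⟨C.trace_ne_zero_of_isUnit W k, fun h => (C.posDef_lsfdMatrixBar W k h).isUnit⟩, ?_,
    fun hU => ⟨hPosDef hU, ?_⟩⟩
  · rw [CellFree.Network.aBar, C.meanB_eq_bBar, C.D_eq_DBar, hXi]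
  · have : Nonempty (Fin M) := ⟨⟨0, hM⟩⟩
    rw [show C.SINR W k = S.SINRBar W k from funext hSINR]
    exact CellFree.isGreatest_rayleigh (hPosDef hU) (S.bBar W k) (S.power_nonneg k)
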